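/- Let $F_{12}$ be the cubic simple graph with vertices $A, A', B, B', 1, 2, \dots, 8$ and the eighteen edges $AA'$, $A3$, $A'2$, $BB'$, $B6$, $B'7$, $23$, $67$, $A8$, $A'5$, $B1$, $B'4$, $12$, $34$, $56$, $78$, $45$, $81$. For a graph $G$, a one-edge addition $G \cup e$ is a multigraph obtained from $G$ in one of three ways: (a) subdivide an edge of $G$ by a new vertex $u$, and add a further vertex $v$, an edge $uv$ and a loop at $v$; (b) subdivide an edge of $G$ by two new vertices $u, v$, and add a second edge $uv$; (c) subdivide two distinct edges $e_1, e_2$ of $G$ by new vertices $u$ and $v$, respectively, and add an edge $uv$; the result is then written $G \cup (e_1 - e_2)$. An embedding of a multigraph into the torus $T^2 = \mathbb{R}/\mathbb{Z} \times \mathbb{R}/\mathbb{Z}$ sends the vertices to distinct points and each edge to a continuous curve $[0,1] \to T^2$ that joins the images of its ends, is injective on $(0,1)$ and meets no vertex there, such that the curves of distinct edges are disjoint away from their end points. A multigraph is toroidal if it has such an embedding. An embedding of $G \cup (e_1 - e_2)$ extends an embedding of $G$ if the two agree on the vertices of $G$, each edge of $G$ other than $e_1, e_2$ has the same image under both, and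 for $i = 1, 2$ the image of $e_i$ is the union of the images of the two parts into which $e_i$ is subdivided. Then the following hold. 1. Every one-edge addition $F_{12} \cup e$ is toroidal. 2. No one-edge addition to $F_{12}$ of type (a) or (b) has girth at least four. If $F_{12} \cup (e_1 - e_2)$ has girth at least four, then some automorphism of $F_{12}$ maps the pair $\{e_1, e_2\}$ to exactly one of the following fourteen pairs (that is, there is exactly one pair in the list that is the image of $\{e_1,e_2\}$ under an automorphism); conversely, each of these fourteen pairs gives a graph of girth at least four: $AA'-BB'$, $AA'-B1$, $AA'-B6$, $AA'-12$, $AA'-23$, $AA'-45$, $AA'-56$, $AA'-67$, $A8-A'5$, $A8-B1$, $A8-B'4$, $A8-12$, $A8-45$, $45-81$. 3. There are three embeddings of $F_{12}$ into the torus (not required to be distinct) such that for each of the fourteen pairs $e_1 - e_2$ in the list at least one of them extends to an embedding of $F_{12} \cup (e_1 - e_2)$. -/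

import Mathlib

namespace Graph

variable {α β : Type*}

/-! ### One-edge additions to a multigraph

The graph obtained from `G` by a one-edge addition has two new vertices, `Sum.inr 0` (called `u`) and
`Sum.inr 1` (called `v`). The subdivided edges of `G` are removed, and the edges `Sum.inr i` are
new. -/

/-- Remove the edges in `D` from `G`, add two new vertices `Sum.inr 0`, `Sum.inr 1`, and add one
new edge `Sum.inr i` for each `i : Fin n`, with the (unordered) pair of ends `new i`. -/
def replaceEdges (G : Graph α β) (D : Set β) {n : ℕ} (new : Fin n → Sym2 (α ⊕ Fin 2)) :
    Graph (α ⊕ Fin 2) (β ⊕ Fin n) where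
  vertexSet := Sum.inl '' G.vertexSet ∪ Set.range Sum.inr
  IsLink e x y :=
    match e with
    | Sum.inl f => f ∉ D ∧ ∃ a b, G.IsLink f a b ∧ x = Sum.inl a ∧ y = Sum.inl b
    | Sum.inr i => new i = s(x, y) ∧
        x ∈ Sum.inl '' G.vertexSet ∪ Set.range Sum.inr ∧
        y ∈ Sum.inl '' G.vertexSet ∪ Set.range Sum.inr
  isLink_symm := by
    rintro (f | i) -
    · exact ⟨fun x y ⟨hD, a, b, h, hx, hy⟩ => ⟨hD, b, a, h.symm, hy, hx⟩⟩
    · exact ⟨fun x y ⟨h, hx, hy⟩ => ⟨h.trans Sym2.eq_swap, hy, hx⟩⟩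
  eq_or_eq_of_isLink_of_isLink := by
    rintro (f | i) x y v w
    · rintro ⟨-, a, b, h, rfl, rfl⟩ ⟨-, c, d, h', rfl, rfl⟩
      exact (h.left_eq_or_eq h').imp (congrArg Sum.inl) (congrArg Sum.inl)
    · rintro ⟨h, -, -⟩ ⟨h', -, -⟩
      rw [h, Sym2.eq_iff] at h'
      exact h'.imp And.left And.left
  left_mem_of_isLink := by
    rintro (f | i) x y
    · rintro ⟨-, a, b, h, rfl, rfl⟩
      exact Or.inl ⟨a, h.left_mem, rfl⟩
    · rintro ⟨-, hx, -⟩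
      exact hx

/-- First kind: subdivide the edge `e` with ends `x`, `y` by `u`, and add the vertex `v`, the edge
`uv` and a loop at `v`. -/
def addLoop (G : Graph α β) (e : β) (x y : α) : Graph (α ⊕ Fin 2) (β ⊕ Fin 4) :=
  G.replaceEdges {e}
    ![s(Sum.inl x, Sum.inr 0), s(Sum.inr 0, Sum.inl y), s(Sum.inr 0, Sum.inr 1),
      s(Sum.inr 1, Sum.inr 1)]

/-- Second kind: subdivide the edge `e` with ends `x`, `y` twice, by `u` and `v`, and add another
edge `uv`. -/
def addParallel (G : Graph α β) (e : β) (x y : α) : Graph (α ⊕ Fin 2) (β ⊕ Fin 4) :=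
  G.replaceEdges {e}
    ![s(Sum.inl x, Sum.inr 0), s(Sum.inr 0, Sum.inr 1), s(Sum.inr 1, Sum.inl y),
      s(Sum.inr 0, Sum.inr 1)]

/-- Third kind: subdivide the edge `e₁` with ends `x₁`, `y₁` by `u` and the edge `e₂` with ends
`x₂`, `y₂` by `v`, and add the edge `uv`. -/
def addChord (G : Graph α β) (e₁ : β) (x₁ y₁ : α) (e₂ : β) (x₂ y₂ : α) :
    Graph (α ⊕ Fin 2) (β ⊕ Fin 5) :=
  G.replaceEdges {e₁, e₂}
    ![s(Sum.inl x₁, Sum.inr 0), s(Sum.inr 0, Sum.inl y₁),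
      s(Sum.inl x₂, Sum.inr 1), s(Sum.inr 1, Sum.inl y₂),
      s(Sum.inr 0, Sum.inr 1)]

/-- `G.IsOneEdgeAddition H` says that `H` is one of the graphs `G ∪ e`. -/
inductive IsOneEdgeAddition (G : Graph α β) :
    {n : ℕ} → Graph (α ⊕ Fin 2) (β ⊕ Fin n) → Prop
  | loop (e : β) (x y : α) (h : G.IsLink e x y) : IsOneEdgeAddition G (G.addLoop e x y)
  | parallel (e : β) (x y : α) (h : G.IsLink e x y) : IsOneEdgeAddition G (G.addParallel e x y)
  | chord (e₁ e₂ : β) (x₁ y₁ x₂ y₂ : α) (h₁ : G.IsLink e₁ x₁ y₁) (h₂ : G.IsLink e₂ x₂ y₂)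
      (hne : e₁ ≠ e₂) : IsOneEdgeAddition G (G.addChord e₁ x₁ y₁ e₂ x₂ y₂)

/-- The graph has no cycle of length at most three: it has neither loops nor parallel edges, and the
girth of its simple graph is at least four. -/
def GirthGeFour (G : Graph α β) : Prop :=
  G.Simple ∧ 4 ≤ G.toSimpleGraph.egirth

/-! ### Embeddings into a topological space -/

/-- The vertex map `p` and the curves `γ` embed the multigraph `G` into `X`: vertices go to distinct
points, each edge goes to a curve that joins the images of its ends, is injective on the open
interval `(0, 1)` and meets no vertex there, and curves of distinct edges are disjoint away from
their end points. Values of `p` and `γ` outside the vertex and edge sets are irrelevant. -/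
structure IsEmbedding {X : Type*} [TopologicalSpace X] (G : Graph α β) (p : α → X)
    (γ : β → C(unitInterval, X)) : Prop where
  injOn_vertex : Set.InjOn p G.vertexSet
  ends : ∀ e x y, G.IsLink e x y → s(γ e 0, γ e 1) = s(p x, p y)
  injOn_curve : ∀ e ∈ G.edgeSet, Set.InjOn (γ e) (Set.Ioo 0 1)
  ne_vertex : ∀ e ∈ G.edgeSet, ∀ t ∈ Set.Ioo (0 : unitInterval) 1, ∀ x ∈ G.vertexSet, γ e t ≠ p x
  ne_curve : ∀ e ∈ G.edgeSet, ∀ f ∈ G.edgeSet, e ≠ f →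
    ∀ s ∈ Set.Ioo (0 : unitInterval) 1, ∀ t ∈ Set.Ioo (0 : unitInterval) 1, γ e s ≠ γ f t

/-- The torus `ℝ/ℤ × ℝ/ℤ`. -/
abbrev Torus : Type := UnitAddCircle × UnitAddCircle

/-- The graph embeds into the torus. -/
def IsToroidal (G : Graph α β) : Prop :=
  ∃ (p : α → Torus) (γ : β → C(unitInterval, Torus)), G.IsEmbedding p γ

/-- The map `(q, δ)` of `G.addChord e₁ x₁ y₁ e₂ x₂ y₂` agrees on `G` with the map `(p, γ)` of `G`:
same points for the vertices of `G`, same curves (as subsets of `X`) for the other edges of `G`,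
and the curve of a subdivided edge is the union of the curves of its two parts. -/
structure ExtendsToChord {X : Type*} [TopologicalSpace X] (G : Graph α β) (e₁ e₂ : β)
    (p : α → X) (γ : β → C(unitInterval, X))
    (q : α ⊕ Fin 2 → X) (δ : β ⊕ Fin 5 → C(unitInterval, X)) : Prop where
  vertex : ∀ x ∈ G.vertexSet, q (Sum.inl x) = p x
  edge : ∀ f ∈ G.edgeSet, f ≠ e₁ → f ≠ e₂ → Set.range (δ (Sum.inl f)) = Set.range (γ f)
  first : Set.range (δ (Sum.inr 0)) ∪ Set.range (δ (Sum.inr 1)) = Set.range (γ e₁)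
  second : Set.range (δ (Sum.inr 2)) ∪ Set.range (δ (Sum.inr 3)) = Set.range (γ e₂)

end Graph

/-! ### The graph `F₁₂` -/

/-- The twelve vertices of `F₁₂`. -/
inductive F12Vertex : Type
  | A | A' | B | B' | v1 | v2 | v3 | v4 | v5 | v6 | v7 | v8
  deriving DecidableEq

open F12Vertex in
/-- The cubic projective plane obstruction `F₁₂`, given by its eighteen edges. -/
def F12 : SimpleGraph F12Vertex :=
  SimpleGraph.fromEdgeSet
    {s(A, A'), s(A, v3), s(A', v2), s(B, B'), s(B, v6), s(B', v7), s(v2, v3), s(v6, v7),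
     s(A, v8), s(A', v5), s(B, v1), s(B', v4), s(v1, v2), s(v3, v4), s(v5, v6), s(v7, v8),
     s(v4, v5), s(v8, v1)}

/-- `F₁₂` as a multigraph; its edges are unordered pairs of vertices. -/
def F12Graph : Graph F12Vertex (Sym2 F12Vertex) := Graph.ofSimpleGraph F12

open F12Vertex in
/-- The fourteen pairs of edges `x₁y₁ - x₂y₂` of `F₁₂`, listed as `((x₁, y₁), (x₂, y₂))`. -/
def F12Case : Fin 14 → (F12Vertex × F12Vertex) × (F12Vertex × F12Vertex) :=
  ![((A, A'), (B, B')), ((A, A'), (B, v1)), ((A, A'), (B, v6)), ((A, A'), (v1, v2)),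
    ((A, A'), (v2, v3)), ((A, A'), (v4, v5)), ((A, A'), (v5, v6)), ((A, A'), (v6, v7)),
    ((A, v8), (A', v5)), ((A, v8), (B, v1)), ((A, v8), (B', v4)), ((A, v8), (v1, v2)),
    ((A, v8), (v4, v5)), ((v4, v5), (v8, v1))]

/-- `F₁₂ ∪ e`, where `e` joins a point of the edge `x₁y₁` to a point of the edge `x₂y₂`. -/
def F12Chord (x₁ y₁ x₂ y₂ : F12Vertex) :
    Graph (F12Vertex ⊕ Fin 2) (Sym2 F12Vertex ⊕ Fin 5) :=
  F12Graph.addChord s(x₁, y₁) x₁ y₁ s(x₂, y₂) x₂ y₂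

/-- Some automorphism of `F₁₂` carries the pair of edges `{x₁y₁, x₂y₂}` to the pair of edges of the
case `i`. -/
def F12SameCase (i : Fin 14) (x₁ y₁ x₂ y₂ : F12Vertex) : Prop :=
  ∃ σ : F12 ≃g F12,
    s(s(σ x₁, σ y₁), s(σ x₂, σ y₂)) =
      s(s((F12Case i).1.1, (F12Case i).1.2), s((F12Case i).2.1, (F12Case i).2.2))

/-! ### Curves and embeddings -/

namespace Graph

open Set unitInterval

variable {α β : Type*} {X : Type*} [TopologicalSpace X] {G : Graph α β} {p : α → X}
  {γ : β → C(I, X)}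

/-! All the topology is reduced to one gadget, the ear (`Graph.IsEar`): a triangle drawn off the
graph, with its base inside an edge `e` and its apex inside an edge `f`. Its altitude is a chord
from `e` to `f`, and subdividing both edges at the ends of the chord embeds `G ∪ (e - f)`
(`IsEmbedding.exists_extendsToChord`). A shallow arc over the base gives an addition of type (b),
and a stem with a loop inside the triangle gives one of type (a).

The ears are found in two straight-line drawings of `F₁₂` on the quotient of the plane by `N • (ℤ ×
ℤ)`. Vertices, open edges and ears lift to relative interiors of convex hulls of at most three
integral points. Two such cells are disjoint on the torus if linear forms separate one from the
translates of the other. Only translations by `N` times a vector with coordinates -1, 0, 1 matter,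
since the cells lie in a square of side `2N`. Thus `Valid` and `ValidEar` are finite checks on
integers.

Eighteen ears suffice: one for each of the fourteen listed pairs, and four for pairs of edges with a
common end. Products of four involutive automorphisms carry every pair of distinct edges to one of
these eighteen pairs (`F12.exists_autEdge_pair`), and relabelling a drawing by an automorphism
carries its ears along. Hence every one-edge addition is toroidal. The third claim needs no
relabelling, because the first fourteen ears lie in the two fixed drawings.

Additions of types (a) and (b) are not simple. A chord between edges with a common end closes a
triangle, while one between disjoint edges closes none, as `F₁₂` is triangle-free. So the same table
of orbits shows that each addition of girth at least four belongs to a listed case. The case is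
unique because walk counts between the ends of the edges are preserved by every automorphism and
differ on the fourteen pairs (`F12.invariants_injective`); the full automorphism group need not be
known. -/

/-- The curve without its end points. -/
def openArc (c : C(I, X)) : Set X := c '' Ioo 0 1

/-- The part of the curve `c` between the parameters `s` and `t`, reparametrized. -/
def subcurve (c : C(I, X)) (s t : I) : C(I, X) :=
  c.comp ⟨Icc.convexComb s t, by fun_prop⟩

/-- The curve traversed backwards. -/
def reverse (c : C(I, X)) : C(I, X) := c.comp ⟨σ, by fun_prop⟩

section Curves

variable {c : C(I, X)} {s t : I}

lemma coe_convexComb (s t r : I) : (Icc.convexComb s t r : ℝ) = (1 - r) * s + r * t := by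
  simp

lemma image_convexComb_Ioo (h : s < t) : Icc.convexComb s t '' Ioo 0 1 = Ioo s t := by
  have h' : (s : ℝ) < t := h
  ext z
  constructor
  · rintro ⟨r, ⟨h0, h1⟩, rfl⟩
    have h0' : (0 : ℝ) < r := h0
    have h1' : (r : ℝ) < 1 := h1
    constructor <;> rw [← Subtype.coe_lt_coe, coe_convexComb] <;> nlinarith
  · rintro ⟨h0, h1⟩
    have h0' : (s : ℝ) < z := h0
    have h1' : (z : ℝ) < t := h1
    have hd : (0 : ℝ) < t - s := by linarith
    have hr0 : 0 < ((z : ℝ) - s) / (t - s) := by apply div_pos <;> linarith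
    have hr1 : ((z : ℝ) - s) / (t - s) < 1 := by rw [div_lt_one hd]; linarith
    refine ⟨⟨_, hr0.le, hr1.le⟩, ⟨hr0, hr1⟩, ?_⟩
    apply Subtype.ext
    rw [coe_convexComb]
    field_simp
    ring

@[simp] lemma subcurve_zero : subcurve c s t 0 = c s := by simp [subcurve]

@[simp] lemma subcurve_one : subcurve c s t 1 = c t := by simp [subcurve]

lemma openArc_subcurve (h : s < t) : openArc (subcurve c s t) = c '' Ioo s t := by
  rw [openArc, ← image_convexComb_Ioo h, image_image]
  rfl

lemma range_subcurve (h : s ≤ t) : range (subcurve c s t) = c '' Icc s t := by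
  rw [← uIcc_of_le h, ← Path.range_subpathAux, ← range_comp]
  rfl

lemma injOn_subcurve (h : s < t) (hc : InjOn c (Ioo 0 1)) : InjOn (subcurve c s t) (Ioo 0 1) := by
  have h' : (s : ℝ) < t := h
  refine hc.comp (f := Icc.convexComb s t) (fun x _ y _ hxy => ?_) ?_
  · have := congrArg (fun z : I => (z : ℝ)) hxy
    simp only [coe_convexComb] at this
    apply Subtype.ext
    have : ((x : ℝ) - y) * (t - s) = 0 := by linarith
    rcases mul_eq_zero.1 this with h | h <;> linarith
  · rw [mapsTo_iff_image_subset, image_convexComb_Ioo h]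
    exact Ioo_subset_Ioo s.2.1 t.2.2

@[simp] lemma reverse_zero : reverse c 0 = c 1 := by simp [reverse]

@[simp] lemma reverse_one : reverse c 1 = c 0 := by simp [reverse]

lemma image_symm_Ioo : σ '' Ioo 0 1 = Ioo 0 1 := by
  ext z
  constructor
  · rintro ⟨r, ⟨h0, h1⟩, rfl⟩
    constructor <;> rw [← Subtype.coe_lt_coe] <;> simpa
  · rintro ⟨h0, h1⟩
    exact ⟨σ z, by constructor <;> rw [← Subtype.coe_lt_coe] <;> simpa, by simp⟩

@[simp] lemma openArc_reverse : openArc (reverse c) = openArc c := by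
  rw [openArc, openArc, ← image_symm_Ioo, image_image, image_symm_Ioo]
  simp [reverse]

@[simp] lemma range_reverse : range (reverse c) = range c :=
  unitInterval.symm_bijective.surjective.range_comp c

lemma injOn_reverse (hc : InjOn c (Ioo 0 1)) : InjOn (reverse c) (Ioo 0 1) :=
  hc.comp unitInterval.symm_bijective.injective.injOn
    (mapsTo_iff_image_subset.2 image_symm_Ioo.subset)

lemma subcurve_union (ht : t ∈ Ioo 0 1) :
    range (subcurve c 0 t) ∪ range (subcurve c t 1) = range c := by
  rw [range_subcurve ht.1.le, range_subcurve ht.2.le, ← image_union, Icc_union_Icc_eq_Icc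
    ht.1.le ht.2.le, ← image_univ]
  congr 1
  ext z
  simp [unitInterval.le_one']

end Curves

/-! ### Drawing new vertices and edges in the complement of a drawing -/

/-- The points off the vertices of `G` and off the edges of `G` not in `D`. -/
def avoid (G : Graph α β) (p : α → X) (γ : β → C(I, X)) (D : Set β) : Set X :=
  {z | (∀ x ∈ G.vertexSet, z ≠ p x) ∧ ∀ f ∈ G.edgeSet, f ∉ D → z ∉ openArc (γ f)}

lemma avoid_mono {D D' : Set β} (h : D ⊆ D') : G.avoid p γ D ⊆ G.avoid p γ D' :=
  fun _ hz => ⟨hz.1, fun f hf hD => hz.2 f hf fun h' => hD (h h')⟩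

/-- Deleting an edge frees its open arc, so the pieces of a subdivided edge can be redrawn along the
old curve. -/
lemma IsEmbedding.openArc_subset_avoid (h : G.IsEmbedding p γ) {e : β} (he : e ∈ G.edgeSet)
    {D : Set β} (hD : e ∈ D) : openArc (γ e) ⊆ G.avoid p γ D := by
  rintro _ ⟨t, ht, rfl⟩
  refine ⟨h.ne_vertex e he t ht, ?_⟩
  rintro f hf hfD ⟨s, hs, hst⟩
  exact h.ne_curve e he f hf (fun h' => hfD (h' ▸ hD)) t ht s hs hst.symm

lemma IsEmbedding.disjoint_openArc (h : G.IsEmbedding p γ) {e f : β} (he : e ∈ G.edgeSet)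
    (hf : f ∈ G.edgeSet) (hne : e ≠ f) : Disjoint (openArc (γ e)) (openArc (γ f)) := by
  rw [Set.disjoint_left]
  rintro _ ⟨t, ht, rfl⟩ ⟨s, hs, hst⟩
  exact h.ne_curve e he f hf hne t ht s hs hst.symm

/-- The curve of an edge can be traversed from either end. -/
lemma IsEmbedding.exists_oriented (h : G.IsEmbedding p γ) {e : β} {x y : α} (hl : G.IsLink e x y) :
    ∃ c : C(I, X), c 0 = p x ∧ c 1 = p y ∧ InjOn c (Ioo 0 1) ∧ openArc c = openArc (γ e) ∧
      range c = range (γ e) := by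
  rcases Sym2.eq_iff.1 (h.ends e x y hl) with h' | h'
  · exact ⟨γ e, h'.1, h'.2, h.injOn_curve e hl.edge_mem, rfl, rfl⟩
  · exact ⟨reverse (γ e), by simp [h'.2], by simp [h'.1],
      injOn_reverse (h.injOn_curve e hl.edge_mem), by simp, by simp⟩

/-- To embed `G.replaceEdges D new`, it suffices to draw the new vertices and the new edges into the
complement of what remains of `G`. -/
theorem IsEmbedding.replaceEdges (h : G.IsEmbedding p γ) {D : Set β} {n : ℕ}
    {new : Fin n → Sym2 (α ⊕ Fin 2)} {w : Fin 2 → X} {c : Fin n → C(I, X)}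
    (hw : ∀ i, w i ∈ G.avoid p γ D) (hw' : w 0 ≠ w 1)
    (hends : ∀ i, Sym2.map (Sum.elim p w) (new i) = s(c i 0, c i 1))
    (hinj : ∀ i, InjOn (c i) (Ioo 0 1))
    (havoid : ∀ i, openArc (c i) ⊆ G.avoid p γ D)
    (hcw : ∀ i j, w j ∉ openArc (c i))
    (hdisj : ∀ i j, i < j → Disjoint (openArc (c i)) (openArc (c j))) :
    (G.replaceEdges D new).IsEmbedding (Sum.elim p w) (Sum.elim γ c) := by
  have hE : ∀ f, Sum.inl f ∈ (G.replaceEdges D new).edgeSet → f ∈ G.edgeSet ∧ f ∉ D := by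
    intro f hf
    obtain ⟨x, y, hD, a, b, hab, -⟩ := (Graph.edge_mem_iff_exists_isLink _ _).1 hf
    exact ⟨hab.edge_mem, hD⟩
  have hV : ∀ x, Sum.inl x ∈ (G.replaceEdges D new).vertexSet → x ∈ G.vertexSet := by
    rintro x (⟨a, ha, hax⟩ | ⟨a, ha⟩)
    · cases hax; exact ha
    · cases ha
  have hw'' : ∀ i j, w i = w j → i = j := by
    intro i j hij
    fin_cases i <;> fin_cases j <;> first | rfl | exact absurd hij hw' | exact absurd hij.symm hw'
  have hdisj' : ∀ i j, i ≠ j → Disjoint (openArc (c i)) (openArc (c j)) := fun i j hij =>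
    (lt_or_gt_of_ne hij).elim (hdisj i j) fun h => (hdisj j i h).symm
  constructor
  · rintro (x | i) hx (y | j) hy hxy
    · exact congrArg _ (h.injOn_vertex (hV x hx) (hV y hy) hxy)
    · exact absurd hxy.symm ((hw j).1 x (hV x hx))
    · exact absurd hxy ((hw i).1 y (hV y hy))
    · exact congrArg _ (hw'' i j hxy)
  · rintro (f | i) x y hl
    · obtain ⟨-, a, b, hab, rfl, rfl⟩ := hl
      exact h.ends f a b hab
    · obtain ⟨hn, -, -⟩ := hl
      simpa [hn] using (hends i).symm
  · rintro (f | i) he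
    · exact h.injOn_curve f (hE f he).1
    · exact hinj i
  · rintro (f | i) he t ht (x | j) hx
    · exact h.ne_vertex f (hE f he).1 t ht x (hV x hx)
    · exact fun h' => (hw j).2 f (hE f he).1 (hE f he).2 ⟨t, ht, h'⟩
    · exact (havoid i ⟨t, ht, rfl⟩).1 x (hV x hx)
    · exact fun h' => hcw i j ⟨t, ht, h'⟩
  · rintro (f | i) he (g | j) he' hne s hs t ht
    · exact h.ne_curve f (hE f he).1 g (hE g he').1 (fun h' => hne (congrArg _ h')) s hs t ht
    · exact fun h' => (havoid j ⟨t, ht, rfl⟩).2 f (hE f he).1 (hE f he).2 ⟨s, hs, h'⟩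
    · exact fun h' => (havoid i ⟨s, hs, rfl⟩).2 g (hE g he').1 (hE g he').2 ⟨t, ht, h'.symm⟩
    · exact fun h' => (hdisj' i j fun hij => hne (congrArg _ hij)).le_bot ⟨⟨s, hs, rfl⟩, ⟨t, ht, h'.symm⟩⟩

end Graph

/-! ### One-edge additions from curves off the drawing -/

namespace Graph

open Set unitInterval

variable {α β : Type*} {X : Type*} [TopologicalSpace X] {G : Graph α β} {p : α → X}
  {γ : β → C(I, X)}

lemma disjoint_image_of_injOn {ι κ : Type*} {f : ι → κ} {S A B : Set ι} (hf : InjOn f S)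
    (hA : A ⊆ S) (hB : B ⊆ S) (h : Disjoint A B) : Disjoint (f '' A) (f '' B) := by
  rw [Set.disjoint_iff_inter_eq_empty, ← hf.image_inter hA hB, h.inter_eq, image_empty]

/-- A point of the open curve of an edge splits it into two curves. -/
lemma IsEmbedding.exists_split (h : G.IsEmbedding p γ) {e : β} {x y : α} (hl : G.IsLink e x y)
    {u : X} (hu : u ∈ openArc (γ e)) :
    ∃ c₀ c₁ : C(I, X), (c₀ 0 = p x ∧ c₀ 1 = u ∧ c₁ 0 = u ∧ c₁ 1 = p y) ∧
      (InjOn c₀ (Ioo 0 1) ∧ InjOn c₁ (Ioo 0 1)) ∧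
      (openArc c₀ ⊆ openArc (γ e) ∧ openArc c₁ ⊆ openArc (γ e)) ∧
      (u ∉ openArc c₀ ∧ u ∉ openArc c₁) ∧ Disjoint (openArc c₀) (openArc c₁) ∧
      range c₀ ∪ range c₁ = range (γ e) := by
  obtain ⟨c, hc0, hc1, hinj, harc, hrange⟩ := h.exists_oriented hl
  rw [← harc] at hu ⊢
  obtain ⟨t, ht, rfl⟩ := hu
  have h0 : Ioo 0 t ⊆ Ioo 0 1 := Ioo_subset_Ioo_right ht.2.le
  have h1 : Ioo t 1 ⊆ Ioo 0 1 := Ioo_subset_Ioo_left ht.1.le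
  refine ⟨subcurve c 0 t, subcurve c t 1, by simp [hc0, hc1],
    ⟨injOn_subcurve ht.1 hinj, injOn_subcurve ht.2 hinj⟩, ?_⟩
  rw [openArc_subcurve ht.1, openArc_subcurve ht.2, subcurve_union ht]
  refine ⟨⟨image_mono h0, image_mono h1⟩, ⟨?_, ?_⟩, ?_, hrange⟩
  · rw [hinj.mem_image_iff h0 ht]; simp
  · rw [hinj.mem_image_iff h1 ht]; simp
  · exact disjoint_image_of_injOn hinj h0 h1 <| Set.disjoint_left.2 fun z hz hz' => lt_asymm hz.2 hz'.1

/-- An injective curve that starts inside the edge `e`, ends inside the edge `f`, and does not meet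
the drawing of `G` in between. -/
structure IsChord (G : Graph α β) (p : α → X) (γ : β → C(I, X)) (e f : β) (χ : C(I, X)) :
    Prop where
  injOn : InjOn χ (Ioo 0 1)
  avoid : openArc χ ⊆ G.avoid p γ ∅
  zero_mem : χ 0 ∈ openArc (γ e)
  one_mem : χ 1 ∈ openArc (γ f)

lemma IsChord.reverse {e f : β} {χ : C(I, X)} (h : G.IsChord p γ e f χ) :
    G.IsChord p γ f e (reverse χ) :=
  ⟨injOn_reverse h.injOn, by simpa using h.avoid, by simpa using h.one_mem,
    by simpa using h.zero_mem⟩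

lemma disjoint_avoid_openArc {e : β} (he : e ∈ G.edgeSet) {S T : Set X}
    (hS : S ⊆ G.avoid p γ ∅) (hT : T ⊆ openArc (γ e)) : Disjoint T S :=
  Set.disjoint_left.2 fun _ hz hz' => (hS hz').2 e he (notMem_empty e) (hT hz)

/-- An embedding of `G` with a chord from `e₁` to `e₂` extends to `G ∪ (e₁ - e₂)`. -/
theorem IsEmbedding.exists_extendsToChord (h : G.IsEmbedding p γ) {e₁ e₂ : β} {x₁ y₁ x₂ y₂ : α}
    (h₁ : G.IsLink e₁ x₁ y₁) (h₂ : G.IsLink e₂ x₂ y₂) (hne : e₁ ≠ e₂) {χ : C(I, X)}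
    (hχ : G.IsChord p γ e₁ e₂ χ) :
    ∃ q δ, (G.addChord e₁ x₁ y₁ e₂ x₂ y₂).IsEmbedding q δ ∧
      G.ExtendsToChord e₁ e₂ p γ q δ := by
  obtain ⟨a₀, a₁, ⟨ha1, ha2, ha3, ha4⟩, ⟨hai0, hai1⟩, ⟨has0, has1⟩, ⟨hau0, hau1⟩, had, har⟩ :=
    h.exists_split h₁ hχ.zero_mem
  obtain ⟨b₀, b₁, ⟨hb1, hb2, hb3, hb4⟩, ⟨hbi0, hbi1⟩, ⟨hbs0, hbs1⟩, ⟨hbu0, hbu1⟩, hbd, hbr⟩ :=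
    h.exists_split h₂ hχ.one_mem
  have hE₁ := h₁.edge_mem
  have hE₂ := h₂.edge_mem
  have hdis := h.disjoint_openArc hE₁ hE₂ hne
  have hD₁ : openArc (γ e₁) ⊆ G.avoid p γ {e₁, e₂} := h.openArc_subset_avoid hE₁ (by simp)
  have hD₂ : openArc (γ e₂) ⊆ G.avoid p γ {e₁, e₂} := h.openArc_subset_avoid hE₂ (by simp)
  have hχ₁ : Disjoint (openArc (γ e₁)) (openArc χ) := disjoint_avoid_openArc hE₁ hχ.avoid subset_rfl
  have hχ₂ : Disjoint (openArc (γ e₂)) (openArc χ) := disjoint_avoid_openArc hE₂ hχ.avoid subset_rfl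
  refine ⟨Sum.elim p ![χ 0, χ 1], Sum.elim γ ![a₀, a₁, b₀, b₁, χ], h.replaceEdges ?_ ?_ ?_ ?_ ?_ ?_ ?_,
    ⟨fun _ _ => rfl, fun _ _ _ _ => rfl, har, hbr⟩⟩
  · exact Fin.forall_fin_two.2 ⟨hD₁ hχ.zero_mem, hD₂ hχ.one_mem⟩
  · exact fun (h' : χ 0 = χ 1) => hdis.le_bot ⟨hχ.zero_mem, h' ▸ hχ.one_mem⟩
  · intro i
    fin_cases i <;> simp [*]
  · intro i
    fin_cases i
    exacts [hai0, hai1, hbi0, hbi1, hχ.injOn]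
  · intro i
    fin_cases i
    exacts [has0.trans hD₁, has1.trans hD₁, hbs0.trans hD₂, hbs1.trans hD₂,
      hχ.avoid.trans (avoid_mono (empty_subset _))]
  · intro i
    refine Fin.forall_fin_two.2 ?_
    fin_cases i
    exacts [⟨hau0, fun h' => hdis.le_bot ⟨has0 h', hχ.one_mem⟩⟩,
      ⟨hau1, fun h' => hdis.le_bot ⟨has1 h', hχ.one_mem⟩⟩,
      ⟨fun h' => hdis.le_bot ⟨hχ.zero_mem, hbs0 h'⟩, hbu0⟩,
      ⟨fun h' => hdis.le_bot ⟨hχ.zero_mem, hbs1 h'⟩, hbu1⟩,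
      ⟨fun h' => hχ₁.le_bot ⟨hχ.zero_mem, h'⟩, fun h' => hχ₂.le_bot ⟨hχ.one_mem, h'⟩⟩]
  · intro i j hij
    fin_cases i <;> fin_cases j <;> try exact absurd hij (by decide)
    exacts [had, hdis.mono has0 hbs0, hdis.mono has0 hbs1, hχ₁.mono_left has0,
      hdis.mono has1 hbs0, hdis.mono has1 hbs1, hχ₁.mono_left has1, hbd,
      hχ₂.mono_left hbs0, hχ₂.mono_left hbs1]

/-- A stem from inside the edge `e` to a new vertex and a loop at this vertex, both off the drawing of
`G`, give a drawing of the addition of the first kind. -/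
theorem IsEmbedding.exists_addLoop (h : G.IsEmbedding p γ) {e : β} {x y : α} (hl : G.IsLink e x y)
    {χ ω : C(I, X)} (hu : χ 0 ∈ openArc (γ e)) (hv : χ 1 ∈ G.avoid p γ ∅)
    (hχi : InjOn χ (Ioo 0 1)) (hωi : InjOn ω (Ioo 0 1)) (hχ : openArc χ ⊆ G.avoid p γ ∅)
    (hω : openArc ω ⊆ G.avoid p γ ∅) (hω0 : ω 0 = χ 1) (hω1 : ω 1 = χ 1) (hχv : χ 1 ∉ openArc χ)
    (hωv : χ 1 ∉ openArc ω) (hdis : Disjoint (openArc χ) (openArc ω)) :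
    ∃ (q : α ⊕ Fin 2 → X) (δ : β ⊕ Fin 4 → C(I, X)), (G.addLoop e x y).IsEmbedding q δ := by
  obtain ⟨a₀, a₁, ⟨ha1, ha2, ha3, ha4⟩, ⟨hai0, hai1⟩, ⟨has0, has1⟩, ⟨hau0, hau1⟩, had, har⟩ :=
    h.exists_split hl hu
  have hE := hl.edge_mem
  have hD : openArc (γ e) ⊆ G.avoid p γ {e} := h.openArc_subset_avoid hE rfl
  have h0 : G.avoid p γ ∅ ⊆ G.avoid p γ {e} := avoid_mono (empty_subset _)
  have hχe : Disjoint (openArc (γ e)) (openArc χ) := disjoint_avoid_openArc hE hχ subset_rfl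
  have hωe : Disjoint (openArc (γ e)) (openArc ω) := disjoint_avoid_openArc hE hω subset_rfl
  have hve : χ 1 ∉ openArc (γ e) := hv.2 e hE (notMem_empty e)
  refine ⟨Sum.elim p ![χ 0, χ 1], Sum.elim γ ![a₀, a₁, χ, ω], h.replaceEdges ?_ ?_ ?_ ?_ ?_ ?_ ?_⟩
  · exact Fin.forall_fin_two.2 ⟨hD hu, h0 hv⟩
  · exact fun (h' : χ 0 = χ 1) => hve (h' ▸ hu)
  · intro i
    fin_cases i <;> simp [*]
  · intro i
    fin_cases i
    exacts [hai0, hai1, hχi, hωi]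
  · intro i
    fin_cases i
    exacts [has0.trans hD, has1.trans hD, hχ.trans h0, hω.trans h0]
  · intro i
    refine Fin.forall_fin_two.2 ?_
    fin_cases i
    exacts [⟨hau0, fun h' => hve (has0 h')⟩, ⟨hau1, fun h' => hve (has1 h')⟩,
      ⟨fun h' => hχe.le_bot ⟨hu, h'⟩, hχv⟩, ⟨fun h' => hωe.le_bot ⟨hu, h'⟩, hωv⟩]
  · intro i j hij
    fin_cases i <;> fin_cases j <;> try exact absurd hij (by decide)
    exacts [had, hχe.mono_left has0, hωe.mono_left has0, hχe.mono_left has1, hωe.mono_left has1,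
      hdis]

/-- A curve off the drawing of `G` that joins two distinct inner points of the edge `e` gives a drawing
of the addition of the second kind. -/
theorem IsEmbedding.exists_addParallel (h : G.IsEmbedding p γ) {e : β} {x y : α}
    (hl : G.IsLink e x y) {χ : C(I, X)} (hχ : G.IsChord p γ e e χ) (hne : χ 0 ≠ χ 1) :
    ∃ (q : α ⊕ Fin 2 → X) (δ : β ⊕ Fin 4 → C(I, X)), (G.addParallel e x y).IsEmbedding q δ := by
  obtain ⟨c, hc0, hc1, hinj, harc, -⟩ := h.exists_oriented hl
  obtain ⟨s, hs, hsu⟩ := harc.symm ▸ hχ.zero_mem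
  obtain ⟨t, ht, htv⟩ := harc.symm ▸ hχ.one_mem
  -- The new vertices must occur in the order `u`, `v` along the edge from `x` to `y`; otherwise the
  -- chord is reversed, which exchanges them.
  wlog hst : s < t generalizing χ s t
  · refine this hχ.reverse (by simpa using hne.symm) t ht (by simpa using htv) s hs
      (by simpa using hsu) (lt_of_le_of_ne (not_lt.1 hst) ?_)
    rintro rfl
    exact hne (hsu.symm.trans htv)
  have hE := hl.edge_mem
  have hD : openArc (γ e) ⊆ G.avoid p γ {e} := h.openArc_subset_avoid hE rfl
  have h0 : G.avoid p γ ∅ ⊆ G.avoid p γ {e} := avoid_mono (empty_subset _)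
  have hχe : Disjoint (openArc c) (openArc χ) := disjoint_avoid_openArc hE hχ.avoid harc.subset
  have hs0 : Ioo 0 s ⊆ Ioo 0 1 := Ioo_subset_Ioo_right hs.2.le
  have hst0 : Ioo s t ⊆ Ioo 0 1 := Ioo_subset_Ioo hs.1.le ht.2.le
  have ht0 : Ioo t 1 ⊆ Ioo 0 1 := Ioo_subset_Ioo_left ht.1.le
  rw [← harc] at hD
  refine ⟨Sum.elim p ![c s, c t],
    Sum.elim γ ![subcurve c 0 s, subcurve c s t, subcurve c t 1, χ], h.replaceEdges ?_ ?_ ?_ ?_ ?_ ?_ ?_⟩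
  · exact Fin.forall_fin_two.2 ⟨hD ⟨s, hs, rfl⟩, hD ⟨t, ht, rfl⟩⟩
  · exact fun h' => hst.ne (hinj hs ht h')
  · intro i
    fin_cases i <;> simp [*]
  · intro i
    fin_cases i
    exacts [injOn_subcurve hs.1 hinj, injOn_subcurve hst hinj, injOn_subcurve ht.2 hinj, hχ.injOn]
  · intro i
    fin_cases i
    exacts [(openArc_subcurve hs.1).trans_subset ((image_mono hs0).trans hD),
      (openArc_subcurve hst).trans_subset ((image_mono hst0).trans hD),
      (openArc_subcurve ht.2).trans_subset ((image_mono ht0).trans hD), hχ.avoid.trans h0]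
  · have key : ∀ {J : Set I} {r : I}, J ⊆ Ioo 0 1 → r ∈ Ioo 0 1 → r ∉ J → c r ∉ c '' J :=
      fun hJ hr hrJ h' => hrJ ((hinj.mem_image_iff hJ hr).1 h')
    intro i
    refine Fin.forall_fin_two.2 ?_
    fin_cases i
    · change c s ∉ openArc (subcurve c 0 s) ∧ c t ∉ openArc (subcurve c 0 s)
      rw [openArc_subcurve hs.1]
      exact ⟨key hs0 hs (by simp), key hs0 ht (by simp [hst.le])⟩
    · change c s ∉ openArc (subcurve c s t) ∧ c t ∉ openArc (subcurve c s t)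
      rw [openArc_subcurve hst]
      exact ⟨key hst0 hs (by simp), key hst0 ht (by simp)⟩
    · change c s ∉ openArc (subcurve c t 1) ∧ c t ∉ openArc (subcurve c t 1)
      rw [openArc_subcurve ht.2]
      exact ⟨key ht0 hs (by simp [hst.le]), key ht0 ht (by simp)⟩
    · exact ⟨fun h' => hχe.le_bot ⟨⟨s, hs, rfl⟩, h'⟩, fun h' => hχe.le_bot ⟨⟨t, ht, rfl⟩, h'⟩⟩
  · have key : ∀ {J J' : Set I}, J ⊆ Ioo 0 1 → J' ⊆ Ioo 0 1 → Disjoint J J' →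
        Disjoint (c '' J) (c '' J') := disjoint_image_of_injOn hinj
    intro i j hij
    fin_cases i <;> fin_cases j <;> try exact absurd hij (by decide)
    · change Disjoint (openArc (subcurve c 0 s)) (openArc (subcurve c s t))
      rw [openArc_subcurve hs.1, openArc_subcurve hst]
      exact key hs0 hst0 (Set.disjoint_left.2 fun z hz hz' => lt_asymm hz.2 hz'.1)
    · change Disjoint (openArc (subcurve c 0 s)) (openArc (subcurve c t 1))
      rw [openArc_subcurve hs.1, openArc_subcurve ht.2]
      exact key hs0 ht0 (Set.disjoint_left.2 fun z hz hz' => lt_asymm (hz.2.trans hst) hz'.1)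
    · change Disjoint (openArc (subcurve c 0 s)) (openArc χ)
      rw [openArc_subcurve hs.1]
      exact hχe.mono_left (image_mono hs0)
    · change Disjoint (openArc (subcurve c s t)) (openArc (subcurve c t 1))
      rw [openArc_subcurve hst, openArc_subcurve ht.2]
      exact key hst0 ht0 (Set.disjoint_left.2 fun z hz hz' => lt_asymm hz.2 hz'.1)
    · change Disjoint (openArc (subcurve c s t)) (openArc χ)
      rw [openArc_subcurve hst]
      exact hχe.mono_left (image_mono hst0)
    · change Disjoint (openArc (subcurve c t 1)) (openArc χ)
      rw [openArc_subcurve ht.2]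
      exact hχe.mono_left (image_mono ht0)

end Graph

/-! ### Ears -/

namespace Graph

open Set unitInterval

variable {α β : Type*} {X : Type*} [TopologicalSpace X] {G : Graph α β} {p : α → X}
  {γ : β → C(I, X)} {e f : β} {z : ℝ × ℝ → X}

/-- The open triangle with corners `(-1/2, 0)`, `(1/2, 0)` and `(0, 1)`. -/
def earRegion : Set (ℝ × ℝ) := {w | 0 < w.2 ∧ |w.1| < (1 - w.2) / 2}

/-- The map `z` draws the triangle `earRegion` off the drawing of `G`, with its base inside the edge
`e` and its apex inside the edge `f`. -/
structure IsEar (G : Graph α β) (p : α → X) (γ : β → C(I, X)) (e f : β) (z : ℝ × ℝ → X) :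
    Prop where
  continuous : Continuous z
  injOn : InjOn z earRegion
  avoid : ∀ w ∈ earRegion, z w ∈ G.avoid p γ ∅
  base : ∀ x ∈ Ioo (-(1 / 2) : ℝ) (1 / 2), z (x, 0) ∈ openArc (γ e)
  base_injOn : InjOn (fun x => z (x, 0)) (Ioo (-(1 / 2) : ℝ) (1 / 2))
  apex : z (0, 1) ∈ openArc (γ f)

/-- The image under `z` of the plane curve `g`. -/
def IsEar.curve (h : G.IsEar p γ e f z) (g : ℝ → ℝ × ℝ) (hg : Continuous g) : C(I, X) :=
  ⟨fun r => z (g r), h.continuous.comp (hg.comp continuous_subtype_val)⟩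

lemma IsEar.injOn_curve (h : G.IsEar p γ e f z) {g : ℝ → ℝ × ℝ} (hg : Continuous g)
    (hr : MapsTo g (Ioo 0 1) earRegion) (hi : InjOn g (Ioo 0 1)) :
    InjOn (h.curve g hg) (Ioo 0 1) := fun _ hs _ ht hst =>
  Subtype.ext (hi hs ht (h.injOn (hr hs) (hr ht) hst))

lemma IsEar.openArc_curve_subset_avoid (h : G.IsEar p γ e f z) {g : ℝ → ℝ × ℝ} (hg : Continuous g)
    (hr : MapsTo g (Ioo 0 1) earRegion) : openArc (h.curve g hg) ⊆ G.avoid p γ ∅ := by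
  rintro _ ⟨r, hr', rfl⟩
  exact h.avoid _ (hr hr')

/-- The chord is the altitude of the triangle. -/
lemma IsEar.exists_isChord (h : G.IsEar p γ e f z) : ∃ χ, G.IsChord p γ e f χ := by
  have hg : Continuous fun r : ℝ => ((0 : ℝ), r) := by fun_prop
  have hr : MapsTo (fun r : ℝ => ((0 : ℝ), r)) (Ioo 0 1) earRegion := fun r hr =>
    ⟨hr.1, by simpa using hr.2⟩
  refine ⟨h.curve _ hg, h.injOn_curve hg hr fun r _ s _ hrs => congrArg Prod.snd hrs,
    h.openArc_curve_subset_avoid hg hr, ?_, ?_⟩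
  · exact h.base 0 (by norm_num)
  · exact h.apex

/-- The chord is a parabola over the middle half of the base. Its first coordinate is strictly
increasing, and its ends differ because the base is embedded. -/
lemma IsEar.exists_isChord_self (h : G.IsEar p γ e f z) :
    ∃ χ, G.IsChord p γ e e χ ∧ χ 0 ≠ χ 1 := by
  have hg : Continuous fun r : ℝ => (-(1 / 4) + r / 2, r * (1 - r)) := by fun_prop
  have hr : MapsTo (fun r : ℝ => (-(1 / 4) + r / 2, r * (1 - r))) (Ioo 0 1) earRegion := by
    rintro r ⟨h0, h1⟩
    exact ⟨mul_pos h0 (sub_pos.2 h1), abs_lt.2 ⟨by nlinarith, by nlinarith⟩⟩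
  have e0 : h.curve _ hg 0 = z (-(1 / 4), 0) := by simp [IsEar.curve]
  have e1 : h.curve _ hg 1 = z (1 / 4, 0) := by
    simp only [IsEar.curve, ContinuousMap.coe_mk, Set.Icc.coe_one]
    norm_num
  refine ⟨h.curve _ hg, ⟨h.injOn_curve hg hr fun r _ s _ hrs => ?_,
    h.openArc_curve_subset_avoid hg hr, ?_, ?_⟩, ?_⟩
  · have := congrArg Prod.fst hrs
    simp only at this
    linarith
  · rw [e0]
    exact h.base _ (by norm_num)
  · rw [e1]
    exact h.base _ (by norm_num)
  · rw [e0, e1]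
    intro h'
    have := h.base_injOn (by norm_num) (by norm_num) h'
    norm_num at this

/-- The stem is the part of the altitude up to height 1/4. The loop starts and ends there and
otherwise stays strictly above height 1/4, so heights alone separate it from the stem. -/
theorem IsEar.exists_addLoop (h : G.IsEar p γ e f z) (hG : G.IsEmbedding p γ) {x y : α}
    (hl : G.IsLink e x y) :
    ∃ (q : α ⊕ Fin 2 → X) (δ : β ⊕ Fin 4 → C(I, X)), (G.addLoop e x y).IsEmbedding q δ := by
  have hg : Continuous fun r : ℝ => ((0 : ℝ), r / 4) := by fun_prop
  have hk : Continuous fun r : ℝ => (r * (1 - r) * (1 - 2 * r) / 2, 1 / 4 + r * (1 - r)) := by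
    fun_prop
  have hv : ((0, 1 / 4) : ℝ × ℝ) ∈ earRegion := ⟨by norm_num, by norm_num⟩
  have hgr : MapsTo (fun r : ℝ => ((0 : ℝ), r / 4)) (Ioo 0 1) earRegion := by
    rintro r ⟨h0, h1⟩
    exact ⟨by simpa, by simp; linarith⟩
  have hkr : MapsTo (fun r : ℝ => (r * (1 - r) * (1 - 2 * r) / 2, 1 / 4 + r * (1 - r)))
      (Ioo 0 1) earRegion := by
    rintro r ⟨h0, h1⟩
    have hr : 0 < r * (1 - r) := mul_pos h0 (sub_pos.2 h1)
    -- With `a = r * (1 - r) ≤ 1 / 4`, the first coordinate is less than `a / 2 ≤ 1 / 8` in absolute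
    -- value, while the triangle has half-width at least 1/4 at height `1 / 4 + a`.
    have hr' : r * (1 - r) ≤ 1 / 4 := by nlinarith [sq_nonneg (1 - 2 * r)]
    refine ⟨by positivity, abs_lt.2 ⟨?_, ?_⟩⟩ <;> simp only <;> nlinarith
  have e0 : h.curve _ hg 0 = z (0, 0) := by simp [IsEar.curve]
  have e1 : h.curve _ hg 1 = z (0, 1 / 4) := by simp [IsEar.curve]
  have f0 : h.curve _ hk 0 = z (0, 1 / 4) := by simp [IsEar.curve]
  have f1 : h.curve _ hk 1 = z (0, 1 / 4) := by simp [IsEar.curve]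
  refine hG.exists_addLoop hl (χ := h.curve _ hg) (ω := h.curve _ hk) ?_ ?_
    (h.injOn_curve hg hgr ?_) (h.injOn_curve hk hkr ?_) (h.openArc_curve_subset_avoid hg hgr)
    (h.openArc_curve_subset_avoid hk hkr) (f0.trans e1.symm) (f1.trans e1.symm) ?_ ?_ ?_
  · rw [e0]
    exact h.base 0 (by norm_num)
  · rw [e1]
    exact h.avoid _ hv
  · intro r _ s _ hrs
    have := congrArg Prod.snd hrs
    simp only at this
    linarith
  · rintro r ⟨h0, h1⟩ s - hrs
    have hr : 0 < r * (1 - r) := mul_pos h0 (sub_pos.2 h1)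
    obtain ⟨h2, h3⟩ := Prod.ext_iff.1 hrs
    simp only at h2 h3
    -- The height determines `r * (1 - r)`, which is positive; dividing the first coordinate by it
    -- recovers `r`.
    have h4 : r * (1 - r) = s * (1 - s) := by linarith
    rw [← h4] at h2
    have : r * (1 - r) * (r - s) = 0 := by linarith
    rcases mul_eq_zero.1 this with h5 | h5 <;> linarith
  · rw [e1]
    rintro ⟨r, hr, hrz⟩
    have hr1 : (r : ℝ) < 1 := hr.2
    have := congrArg Prod.snd (h.injOn (hgr hr) hv hrz)
    simp only at this
    linarith
  · rw [e1]
    rintro ⟨r, hr, hrz⟩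
    have hr' : 0 < (r : ℝ) * (1 - r) := mul_pos hr.1 (sub_pos.2 hr.2)
    have := congrArg Prod.snd (h.injOn (hkr hr) hv hrz)
    simp only at this
    linarith
  · rw [Set.disjoint_left]
    rintro _ ⟨r, hr, rfl⟩ ⟨s, hs, hsr⟩
    have hr1 : (r : ℝ) < 1 := hr.2
    have hs' : 0 < (s : ℝ) * (1 - s) := mul_pos hs.1 (sub_pos.2 hs.2)
    have := congrArg Prod.snd (h.injOn (hkr hs) (hgr hr) hsr)
    simp only at this
    linarith

/-! ### Relabelling a drawing by an automorphism -/

section Pullback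

variable {φ : α → α} {ψ : β → β}

/-- An embedding can be composed with an endomorphism of the graph that is injective on vertices and
on edges. -/
lemma IsEmbedding.comp (h : G.IsEmbedding p γ) (hφ : φ.Injective) (hψ : ψ.Injective)
    (hV : ∀ x ∈ G.vertexSet, φ x ∈ G.vertexSet)
    (hl : ∀ e x y, G.IsLink e x y → G.IsLink (ψ e) (φ x) (φ y)) :
    G.IsEmbedding (p ∘ φ) (γ ∘ ψ) := by
  have hE : ∀ e ∈ G.edgeSet, ψ e ∈ G.edgeSet := fun e he => by
    obtain ⟨x, y, hxy⟩ := (G.edge_mem_iff_exists_isLink e).1 he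
    exact (hl e x y hxy).edge_mem
  exact ⟨h.injOn_vertex.comp hφ.injOn hV, fun e x y hxy => h.ends _ _ _ (hl e x y hxy),
    fun e he => h.injOn_curve _ (hE e he),
    fun e he t ht x hx => h.ne_vertex _ (hE e he) t ht _ (hV x hx),
    fun e he f hf hne => h.ne_curve _ (hE e he) _ (hE f hf) (hψ.ne hne)⟩

/-- The picture stays the same and only its labels change, so the same triangle serves. One ear thus
covers a whole orbit of pairs of edges. -/
lemma IsEar.comp (h : G.IsEar p γ (ψ e) (ψ f) z)
    (hV : ∀ x ∈ G.vertexSet, φ x ∈ G.vertexSet)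
    (hl : ∀ e x y, G.IsLink e x y → G.IsLink (ψ e) (φ x) (φ y)) :
    G.IsEar (p ∘ φ) (γ ∘ ψ) e f z := by
  refine ⟨h.continuous, h.injOn, fun w hw => ⟨fun x hx => (h.avoid w hw).1 _ (hV x hx),
    fun g hg _ => (h.avoid w hw).2 _ ?_ (notMem_empty _)⟩, h.base, h.base_injOn, h.apex⟩
  obtain ⟨x, y, hxy⟩ := (G.edge_mem_iff_exists_isLink g).1 hg
  exact (hl g x y hxy).edge_mem

end Pullback

end Graph

/-! ### Separation of triangles in the plane and on the torus -/

/-- Three points of the plane with integral coordinates, not necessarily distinct. -/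
structure Cell where
  a : ℤ × ℤ
  b : ℤ × ℤ
  c : ℤ × ℤ

namespace Cell

open Set

/-- The point with barycentric coordinates `u`, `v`, `w`. -/
def point (T : Cell) (u v w : ℝ) : ℝ × ℝ :=
  (u * T.a.1 + v * T.b.1 + w * T.c.1, u * T.a.2 + v * T.b.2 + w * T.c.2)

/-- The relative interior of the convex hull of the three points. -/
def interior (T : Cell) : Set (ℝ × ℝ) :=
  {z | ∃ u v w : ℝ, 0 < u ∧ 0 < v ∧ 0 < w ∧ u + v + w = 1 ∧ z = T.point u v w}

/-- The linear form with integral coefficients `n`. -/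
def form (n z : ℤ × ℤ) : ℤ := n.1 * z.1 + n.2 * z.2

/-- The largest value of a form on the three points. -/
def top (n : ℤ × ℤ) (T : Cell) : ℤ := max (form n T.a) (max (form n T.b) (form n T.c))

/-- The smallest value of a form on the three points. -/
def bot (n : ℤ × ℤ) (T : Cell) : ℤ := min (form n T.a) (min (form n T.b) (form n T.c))

/-- The form `n` is on `T` at most as large as on `S`, and it is not constant on their union. -/
def below (n : ℤ × ℤ) (T S : Cell) : Bool :=
  decide (T.top n ≤ S.bot n) && decide (T.bot n < S.top n)

/-- A form that vanishes on the difference of `x` and `y`. -/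
def normal (x y : ℤ × ℤ) : ℤ × ℤ := (x.2 - y.2, y.1 - x.1)

/-- Some coordinate or some side of `T` or `S` separates `T` and `S`. -/
def separated (T S : Cell) : Bool :=
  -- The coordinate forms are needed for collinear cells, such as an open edge and its own end
  -- point: there every side normal is constant.
  [(1, 0), (0, 1), normal T.a T.b, normal T.b T.c, normal T.c T.a, normal S.a S.b, normal S.b S.c,
    normal S.c S.a].any fun n => below n T S || below n S T

/-- Translation by `d`. -/
def shift (T : Cell) (d : ℤ × ℤ) : Cell := ⟨T.a + d, T.b + d, T.c + d⟩

/-- All coordinates are at least `-N` and less than `N`. -/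
def inBox (N : ℕ) (T : Cell) : Bool :=
  [T.a.1, T.a.2, T.b.1, T.b.2, T.c.1, T.c.2].all fun x => decide (-N ≤ x) && decide (x < N)

/-- The nonzero vectors with coordinates in `{-1, 0, 1}`. -/
def neighbours : List (ℤ × ℤ) :=
  [(1, 0), (-1, 0), (0, 1), (0, -1), (1, 1), (1, -1), (-1, 1), (-1, -1)]

/-- `T` is separated from the translates of `S` by `N` times the vectors in `L`. -/
def separatedShifts (N : ℕ) (L : List (ℤ × ℤ)) (T S : Cell) : Bool :=
  L.all fun d => separated T (S.shift (N * d.1, N * d.2))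

variable {T S : Cell} {n : ℤ × ℤ} {N : ℕ}

/-- At a common point the form is at most and at least `T.top n`. All barycentric weights are
positive, so the form has this value at all six corners, against the strict inequality in `below`.
The argument covers degenerate cells as well. -/
lemma disjoint_of_below (h : below n T S = true) : Disjoint T.interior S.interior := by
  simp only [below, Bool.and_eq_true, decide_eq_true_eq] at h
  obtain ⟨h1, h2⟩ := h
  rw [Set.disjoint_left]
  rintro z ⟨u, v, w, hu, hv, hw, hs, hz⟩ ⟨u', v', w', hu', hv', hw', hs', hz'⟩
  have hx := congrArg Prod.fst (hz.symm.trans hz')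
  have hy := congrArg Prod.snd (hz.symm.trans hz')
  simp only [point] at hx hy
  have ha : form n T.a ≤ T.top n := by simp [top]
  have hb : form n T.b ≤ T.top n := by simp [top]
  have hc : form n T.c ≤ T.top n := by simp [top]
  have ha' : T.top n ≤ form n S.a := h1.trans (by simp [bot])
  have hb' : T.top n ≤ form n S.b := h1.trans (by simp [bot])
  have hc' : T.top n ≤ form n S.c := h1.trans (by simp [bot])
  have hne : ¬ (form n T.a = T.top n ∧ form n T.b = T.top n ∧ form n T.c = T.top n ∧
      form n S.a = T.top n ∧ form n S.b = T.top n ∧ form n S.c = T.top n) := by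
    rintro ⟨e1, e2, e3, e4, e5, e6⟩
    rw [bot, top, e1, e2, e3, e4, e5, e6] at h2
    simp at h2
  have hf : ∀ x : ℤ × ℤ, ((form n x : ℤ) : ℝ) = n.1 * x.1 + n.2 * x.2 := fun x => by
    simp [form]
  have key : u * ((T.top n : ℝ) - form n T.a) + v * ((T.top n : ℝ) - form n T.b)
      + w * ((T.top n : ℝ) - form n T.c) + u' * ((form n S.a : ℝ) - T.top n)
      + v' * ((form n S.b : ℝ) - T.top n) + w' * ((form n S.c : ℝ) - T.top n) = 0 := by
    simp only [hf]
    linear_combination (T.top n : ℝ) * hs - (T.top n : ℝ) * hs' - (n.1 : ℝ) * hx - (n.2 : ℝ) * hy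
  have cast : ∀ {x y : ℤ}, x ≤ y → (0 : ℝ) ≤ (y : ℝ) - x := fun h => by
    have : (_ : ℝ) ≤ _ := Int.cast_le.2 h
    linarith
  have p1 := mul_nonneg hu.le (cast ha)
  have p2 := mul_nonneg hv.le (cast hb)
  have p3 := mul_nonneg hw.le (cast hc)
  have p4 := mul_nonneg hu'.le (cast ha')
  have p5 := mul_nonneg hv'.le (cast hb')
  have p6 := mul_nonneg hw'.le (cast hc')
  have eq : ∀ {r : ℝ} {x y : ℤ}, 0 < r → r * ((y : ℝ) - x) = 0 → x = y := fun hr h => by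
    have := (mul_eq_zero.1 h).resolve_left hr.ne'
    exact_mod_cast (sub_eq_zero.1 this).symm
  exact hne ⟨eq hu (by linarith), eq hv (by linarith), eq hw (by linarith),
    (eq hu' (by linarith)).symm, (eq hv' (by linarith)).symm, (eq hw' (by linarith)).symm⟩

lemma disjoint_of_separated (h : separated T S = true) : Disjoint T.interior S.interior := by
  rw [separated, List.any_eq_true] at h
  obtain ⟨n, -, hn⟩ := h
  rw [Bool.or_eq_true] at hn
  exact hn.elim disjoint_of_below fun h => (disjoint_of_below h).symm

lemma mem_interior_shift {z : ℝ × ℝ} {d : ℤ × ℤ} (hz : z ∈ T.interior) :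
    (z.1 + d.1, z.2 + d.2) ∈ (T.shift d).interior := by
  obtain ⟨u, v, w, hu, hv, hw, hs, rfl⟩ := hz
  refine ⟨u, v, w, hu, hv, hw, hs, Prod.ext ?_ ?_⟩ <;> simp [shift, point]
  · linear_combination (-d.1 : ℝ) * hs
  · linear_combination (-d.2 : ℝ) * hs

lemma bounds_of_inBox (h : T.inBox N = true) {z : ℝ × ℝ} (hz : z ∈ T.interior) :
    (-N ≤ z.1 ∧ z.1 < N) ∧ (-N ≤ z.2 ∧ z.2 < N) := by
  obtain ⟨u, v, w, hu, hv, hw, hs, rfl⟩ := hz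
  simp only [inBox, List.all_cons, List.all_nil, Bool.and_true, Bool.and_eq_true,
    decide_eq_true_eq] at h
  have key : ∀ {x y t : ℤ}, (-N ≤ x ∧ x < N) → (-N ≤ y ∧ y < N) → (-N ≤ t ∧ t < N) →
      (-N ≤ u * x + v * y + w * t ∧ u * x + v * y + w * t < N) := by
    intro x y t hx hy ht
    have l : ∀ {x : ℤ}, -N ≤ x → (-N : ℝ) ≤ x := fun h => by exact_mod_cast h
    have r : ∀ {x : ℤ}, x < N → (x : ℝ) < N := fun h => by exact_mod_cast h
    have e : (N : ℝ) = u * N + v * N + w * N := by linear_combination (-N : ℝ) * hs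
    have := mul_le_mul_of_nonneg_left (l hx.1) hu.le
    have := mul_le_mul_of_nonneg_left (l hy.1) hv.le
    have := mul_le_mul_of_nonneg_left (l ht.1) hw.le
    have := mul_lt_mul_of_pos_left (r hx.2) hu
    have := mul_lt_mul_of_pos_left (r hy.2) hv
    have := mul_lt_mul_of_pos_left (r ht.2) hw
    constructor <;> linarith
  exact ⟨key h.1 h.2.2.1 h.2.2.2.2.1, key h.2.1 h.2.2.2.1 h.2.2.2.2.2⟩

/-! ### Passage from the plane to the torus -/

/-- The covering of the torus by the plane with deck translations `N • (ℤ × ℤ)`. -/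
noncomputable def proj (N : ℕ) (z : ℝ × ℝ) : Graph.Torus :=
  (((z.1 / N : ℝ) : UnitAddCircle), ((z.2 / N : ℝ) : UnitAddCircle))

@[fun_prop]
lemma continuous_proj (N : ℕ) : Continuous (proj N) := by
  have : Continuous fun x : ℝ => (x : UnitAddCircle) := AddCircle.continuous_mk' 1
  unfold proj
  fun_prop

lemma coe_div_eq_iff (hN : 0 < N) {x y : ℝ} :
    ((x / N : ℝ) : UnitAddCircle) = ((y / N : ℝ) : UnitAddCircle) ↔ ∃ k : ℤ, x = y + N * k := by
  have hN' : (N : ℝ) ≠ 0 := by positivity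
  rw [← sub_eq_zero, ← AddCircle.coe_sub, AddCircle.coe_eq_zero_iff]
  refine exists_congr fun k => ?_
  rw [zsmul_eq_mul, mul_one, ← sub_div, eq_div_iff hN']
  constructor <;> intro h <;> linarith

lemma proj_eq_iff (hN : 0 < N) {z w : ℝ × ℝ} :
    proj N z = proj N w ↔ ∃ d : ℤ × ℤ, z = (w.1 + (N * d.1 : ℤ), w.2 + (N * d.2 : ℤ)) := by
  simp only [proj, Prod.ext_iff, coe_div_eq_iff hN, Prod.exists]
  push_cast
  constructor
  · rintro ⟨⟨k, hk⟩, l, hl⟩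
    exact ⟨k, l, hk, hl⟩
  · rintro ⟨k, l, hk, hl⟩
    exact ⟨⟨k, hk⟩, l, hl⟩

/-- Coordinates in the half-open interval from `-N` to `N` differ by less than `2 * N`, so a deck
translation between two such points has coefficients -1, 0 or 1. This makes the disjointness check
finite without confining the cells to one fundamental domain. -/
lemma mem_of_inBox (hT : T.inBox N = true) (hS : S.inBox N = true) {z w : ℝ × ℝ}
    (hz : z ∈ T.interior) (hw : w ∈ S.interior) {d : ℤ × ℤ}
    (h : z = (w.1 + (N * d.1 : ℤ), w.2 + (N * d.2 : ℤ))) : d ∈ (0, 0) :: neighbours := by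
  obtain ⟨⟨h1, h2⟩, h3, h4⟩ := bounds_of_inBox hT hz
  obtain ⟨⟨h5, h6⟩, h7, h8⟩ := bounds_of_inBox hS hw
  have key : ∀ {x y : ℝ} {k : ℤ}, -N ≤ x → x < N → -N ≤ y → y < N → x = y + (N * k : ℤ) →
      k = -1 ∨ k = 0 ∨ k = 1 := by
    intro x y k hx hx' hy hy' hxy
    push_cast at hxy
    have hN : (0 : ℝ) < N := by linarith
    have hl : (-2 : ℝ) < k := by
      by_contra! hk
      nlinarith
    have hr : (k : ℝ) < 2 := by
      by_contra! hk
      nlinarith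
    have hl' : -2 < k := by exact_mod_cast hl
    have hr' : k < 2 := by exact_mod_cast hr
    omega
  obtain ⟨k, l⟩ := d
  have hk := key h1 h2 h5 h6 (congrArg Prod.fst h)
  have hl := key h3 h4 h7 h8 (congrArg Prod.snd h)
  rcases hk with rfl | rfl | rfl <;> rcases hl with rfl | rfl | rfl <;> simp [neighbours]

/-- Cells that are separated in the plane are disjoint on the torus. -/
lemma proj_ne (hN : 0 < N) (hT : T.inBox N = true) (hS : S.inBox N = true)
    (h : separatedShifts N ((0, 0) :: neighbours) T S = true) {z w : ℝ × ℝ} (hz : z ∈ T.interior)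
    (hw : w ∈ S.interior) : proj N z ≠ proj N w := by
  intro hzw
  obtain ⟨d, hd⟩ := (proj_eq_iff hN).1 hzw
  have hsep := List.all_eq_true.1 h d (mem_of_inBox hT hS hz hw hd)
  exact (disjoint_of_separated hsep).le_bot ⟨hz, hd ▸ mem_interior_shift hw⟩

/-- A cell that is separated from its translates is mapped injectively to the torus. -/
lemma injOn_proj (hN : 0 < N) (hT : T.inBox N = true)
    (h : separatedShifts N neighbours T T = true) : InjOn (proj N) T.interior := by
  intro z hz w hw hzw
  obtain ⟨d, hd⟩ := (proj_eq_iff hN).1 hzw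
  rcases List.mem_cons.1 (mem_of_inBox hT hT hz hw hd) with rfl | hd'
  · simpa using hd
  · have hsep := List.all_eq_true.1 h d hd'
    exact ((disjoint_of_separated hsep).le_bot ⟨hz, hd ▸ mem_interior_shift hw⟩).elim

end Cell

/-! ### Straight drawings of `F₁₂` on the torus -/

open F12Vertex in
instance : Fintype F12Vertex :=
  ⟨⟨[A, A', B, B', v1, v2, v3, v4, v5, v6, v7, v8], by decide⟩, fun x => by cases x <;> decide⟩

open F12Vertex in
/-- The ends of the edges of `F₁₂`. -/
def F12Ends : Fin 18 → F12Vertex × F12Vertex :=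
  ![(A, A'), (A, v3), (A', v2), (B, B'), (B, v6), (B', v7), (v2, v3), (v6, v7), (A, v8), (A', v5),
    (B, v1), (B', v4), (v1, v2), (v3, v4), (v5, v6), (v7, v8), (v4, v5), (v8, v1)]

/-- The edges of `F₁₂`. -/
def F12Edge (i : Fin 18) : Sym2 F12Vertex := s((F12Ends i).1, (F12Ends i).2)

lemma F12Edge_injective : F12Edge.Injective := by
  have : ∀ i j, F12Edge i = F12Edge j → i = j := by decide +kernel
  exact this

/-- Numbering the edges makes adjacency decidable and turns statements about edges into finite
computations. -/
lemma F12_adj {x y : F12Vertex} : F12.Adj x y ↔ ∃ i, F12Edge i = s(x, y) := by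
  have h : ∀ i, (F12Ends i).1 ≠ (F12Ends i).2 := by decide +kernel
  rw [F12, SimpleGraph.fromEdgeSet_adj]
  constructor
  · rintro ⟨h, -⟩
    simp only [Set.mem_insert_iff, Set.mem_singleton_iff] at h
    rcases h with h | h | h | h | h | h | h | h | h | h | h | h | h | h | h | h | h | h <;> rw [h]
    exacts [⟨0, rfl⟩, ⟨1, rfl⟩, ⟨2, rfl⟩, ⟨3, rfl⟩, ⟨4, rfl⟩, ⟨5, rfl⟩, ⟨6, rfl⟩, ⟨7, rfl⟩, ⟨8, rfl⟩,
      ⟨9, rfl⟩, ⟨10, rfl⟩, ⟨11, rfl⟩, ⟨12, rfl⟩, ⟨13, rfl⟩, ⟨14, rfl⟩, ⟨15, rfl⟩, ⟨16, rfl⟩, ⟨17, rfl⟩]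
  · rintro ⟨i, hi⟩
    refine ⟨?_, ?_⟩
    · rw [← hi]
      fin_cases i <;> simp [F12Edge, F12Ends]
    · rintro rfl
      have := h i
      rw [F12Edge, Sym2.eq_iff] at hi
      grind

instance : DecidableRel F12.Adj := fun _ _ => decidable_of_iff _ F12_adj.symm

lemma F12Graph_isLink {e : Sym2 F12Vertex} {x y : F12Vertex} :
    F12Graph.IsLink e x y ↔ e = s(x, y) ∧ F12.Adj x y := by
  constructor
  · rintro ⟨rfl, h⟩
    exact ⟨rfl, h⟩
  · rintro ⟨rfl, h⟩
    exact ⟨rfl, h⟩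

lemma F12Graph_mem_edgeSet {e : Sym2 F12Vertex} : e ∈ F12Graph.edgeSet ↔ ∃ i, F12Edge i = e := by
  induction e with
  | h x y => exact F12_adj

open Classical in
/-- The index of an edge of `F₁₂`. -/
noncomputable def F12Index (e : Sym2 F12Vertex) : Fin 18 :=
  -- The value 0 off the edge set is arbitrary; embeddings only constrain the curves of edges.
  if h : ∃ i, F12Edge i = e then h.choose else 0

@[simp]
lemma F12Index_edge (i : Fin 18) : F12Index (F12Edge i) = i := by
  have h : ∃ j, F12Edge j = F12Edge i := ⟨i, rfl⟩
  rw [F12Index, dif_pos h]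
  exact F12Edge_injective h.choose_spec

/-- Positions of the vertices of `F₁₂` in the plane, for a drawing on the torus that is the quotient
of the plane by `N • (ℤ × ℤ)`. The edge `i` runs straight from the position of its first end to a
translate of the position of its second end, by `N • off i`. -/
structure F12Drawing where
  N : ℕ
  pos : F12Vertex → ℤ × ℤ
  off : Fin 18 → ℤ × ℤ

namespace F12Drawing

open Set Cell unitInterval

variable (D : F12Drawing)

/-- The second end of the lift of the edge `i`. -/
def head (i : Fin 18) : ℤ × ℤ :=
  D.pos (F12Ends i).2 + (D.N * (D.off i).1, D.N * (D.off i).2)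

/-- The cell of a vertex. -/
def vertexCell (x : F12Vertex) : Cell := ⟨D.pos x, D.pos x, D.pos x⟩

/-- The cell of an edge. -/
def edgeCell (i : Fin 18) : Cell := ⟨D.pos (F12Ends i).1, D.pos (F12Ends i).1, D.head i⟩

/-- The triangle on the edge `i` with the midpoint of a translate of the edge `j` as its apex. -/
def earCell (i j : Fin 18) (d : ℤ × ℤ) : Cell :=
  ⟨D.pos (F12Ends i).1, D.head i,
    (((D.pos (F12Ends j).1).1 + (D.head j).1) / 2 + D.N * d.1,
      ((D.pos (F12Ends j).1).2 + (D.head j).2) / 2 + D.N * d.2)⟩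

/-- The cells of a drawing are pairwise disjoint on the torus. -/
structure Valid : Prop where
  pos_N : 0 < D.N
  vertex_inBox : ∀ x, (D.vertexCell x).inBox D.N = true
  edge_inBox : ∀ i, (D.edgeCell i).inBox D.N = true
  edge_ne : ∀ i, D.pos (F12Ends i).1 ≠ D.head i
  vertex_vertex : ∀ x y, x ≠ y →
    separatedShifts D.N ((0, 0) :: neighbours) (D.vertexCell x) (D.vertexCell y) = true
  edge_vertex : ∀ i x,
    separatedShifts D.N ((0, 0) :: neighbours) (D.edgeCell i) (D.vertexCell x) = true
  edge_edge : ∀ i j, i < j →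
    separatedShifts D.N ((0, 0) :: neighbours) (D.edgeCell i) (D.edgeCell j) = true
  edge_self : ∀ i, separatedShifts D.N neighbours (D.edgeCell i) (D.edgeCell i) = true

/-- The triangle `D.earCell i j d` is nondegenerate, and on the torus it is embedded and disjoint from
the drawing. -/
structure ValidEar (i j : Fin 18) (d : ℤ × ℤ) : Prop where
  inBox : (D.earCell i j d).inBox D.N = true
  ne : form (normal (D.earCell i j d).a (D.earCell i j d).b) (D.earCell i j d).a ≠
    form (normal (D.earCell i j d).a (D.earCell i j d).b) (D.earCell i j d).c
  even_fst : 2 ∣ (D.pos (F12Ends j).1).1 + (D.head j).1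
  even_snd : 2 ∣ (D.pos (F12Ends j).1).2 + (D.head j).2
  vertex : ∀ x,
    separatedShifts D.N ((0, 0) :: neighbours) (D.earCell i j d) (D.vertexCell x) = true
  edge : ∀ k, separatedShifts D.N ((0, 0) :: neighbours) (D.earCell i j d) (D.edgeCell k) = true
  self : separatedShifts D.N neighbours (D.earCell i j d) (D.earCell i j d) = true

/-- The point of the torus for the vertex `x`. -/
noncomputable def vertexPoint (x : F12Vertex) : Graph.Torus :=
  proj D.N ((D.pos x).1, (D.pos x).2)

/-- The lift of the curve of the edge `i`. -/
noncomputable def lift (i : Fin 18) (t : ℝ) : ℝ × ℝ := (D.edgeCell i).point 0 (1 - t) t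

/-- The curve for the edge `i`. -/
noncomputable def edgeCurve (i : Fin 18) : C(I, Graph.Torus) where
  toFun t := proj D.N (D.lift i t)
  continuous_toFun := by
    unfold lift point
    fun_prop

/-- The curve for the edge `e`. -/
noncomputable def curve (e : Sym2 F12Vertex) : C(I, Graph.Torus) := D.edgeCurve (F12Index e)

variable {D}

/-- The first two corners of an edge cell coincide, so the weight `1 - t` can be shared between them
to make all three weights positive. -/
lemma lift_mem {i : Fin 18} {t : ℝ} (h0 : 0 < t) (h1 : t < 1) :
    D.lift i t ∈ (D.edgeCell i).interior := by
  refine ⟨(1 - t) / 2, (1 - t) / 2, t, by linarith, by linarith, h0, by ring, ?_⟩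
  simp only [lift, point, edgeCell]
  ext <;> simp only <;> ring

lemma vertex_mem (x : F12Vertex) :
    (((D.pos x).1 : ℝ), ((D.pos x).2 : ℝ)) ∈ (D.vertexCell x).interior := by
  refine ⟨1 / 3, 1 / 3, 1 / 3, by norm_num, by norm_num, by norm_num, by norm_num, ?_⟩
  simp only [point, vertexCell]
  ext <;> simp only <;> ring

lemma openArc_edgeCurve (i : Fin 18) :
    Graph.openArc (D.edgeCurve i) ⊆ proj D.N '' (D.edgeCell i).interior := by
  rintro _ ⟨t, ht, rfl⟩
  exact ⟨_, lift_mem ht.1 ht.2, rfl⟩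

lemma Valid.injOn_proj_lift (h : D.Valid) (i : Fin 18) :
    InjOn (fun t => proj D.N (D.lift i t)) (Ioo 0 1) := by
  intro s hs t ht hst
  have := injOn_proj h.pos_N (h.edge_inBox i) (h.edge_self i) (lift_mem hs.1 hs.2)
    (lift_mem ht.1 ht.2) hst
  simp only [lift, point, edgeCell, Prod.ext_iff] at this
  by_contra hne
  apply h.edge_ne i
  have key : ∀ {a b : ℤ}, 0 * (a : ℝ) + (1 - s) * a + s * b = 0 * (a : ℝ) + (1 - t) * a + t * b →
      a = b := by
    intro a b hab
    have : (s - t) * ((b : ℝ) - a) = 0 := by linear_combination hab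
    have := (mul_eq_zero.1 this).resolve_left (sub_ne_zero.2 hne)
    exact_mod_cast (sub_eq_zero.1 this).symm
  exact Prod.ext (key this.1) (key this.2)

lemma Valid.injOn_edgeCurve (h : D.Valid) (i : Fin 18) : InjOn (D.edgeCurve i) (Ioo 0 1) :=
  fun _ hs _ ht hst => Subtype.ext (h.injOn_proj_lift i hs ht hst)

lemma Valid.edgeCurve_zero (i : Fin 18) : D.edgeCurve i 0 = D.vertexPoint (F12Ends i).1 := by
  simp [edgeCurve, lift, point, vertexPoint, edgeCell]

lemma Valid.edgeCurve_one (h : D.Valid) (i : Fin 18) :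
    D.edgeCurve i 1 = D.vertexPoint (F12Ends i).2 := by
  refine (proj_eq_iff h.pos_N).2 ⟨D.off i, ?_⟩
  simp [lift, point, edgeCell, head]

/-- A valid drawing is an embedding. -/
theorem Valid.isEmbedding (h : D.Valid) : F12Graph.IsEmbedding D.vertexPoint D.curve := by
  constructor
  · intro x _ y _ hxy
    by_contra hne
    exact proj_ne h.pos_N (h.vertex_inBox x) (h.vertex_inBox y) (h.vertex_vertex x y hne)
      (vertex_mem x) (vertex_mem y) hxy
  · intro e x y he
    obtain ⟨i, rfl⟩ := F12Graph_mem_edgeSet.1 he.edge_mem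
    obtain ⟨he, -⟩ := F12Graph_isLink.1 he
    rw [curve, F12Index_edge, Valid.edgeCurve_zero, h.edgeCurve_one]
    rcases Sym2.eq_iff.1 he with ⟨h1, h2⟩ | ⟨h1, h2⟩
    · rw [h1, h2]
    · rw [h1, h2, Sym2.eq_swap]
  · intro e _
    exact h.injOn_edgeCurve _
  · intro e _ t ht x _ htx
    exact proj_ne h.pos_N (h.edge_inBox _) (h.vertex_inBox x) (h.edge_vertex _ x)
      (lift_mem ht.1 ht.2) (vertex_mem x) htx
  · intro e he f hf hne s hs t ht hst
    obtain ⟨i, rfl⟩ := F12Graph_mem_edgeSet.1 he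
    obtain ⟨j, rfl⟩ := F12Graph_mem_edgeSet.1 hf
    simp only [curve, F12Index_edge] at hst
    -- Disjointness of two edges is checked only for increasing indices.
    rcases lt_trichotomy i j with hij | rfl | hij
    · exact proj_ne h.pos_N (h.edge_inBox i) (h.edge_inBox j) (h.edge_edge i j hij)
        (lift_mem hs.1 hs.2) (lift_mem ht.1 ht.2) hst
    · exact hne rfl
    · exact proj_ne h.pos_N (h.edge_inBox j) (h.edge_inBox i) (h.edge_edge j i hij)
        (lift_mem ht.1 ht.2) (lift_mem hs.1 hs.2) hst.symm

/-! ### Ears from triangles in a straight drawing -/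

/-- The affine parametrization of the triangle `D.earCell i j d`. -/
noncomputable def earLift (D : F12Drawing) (i j : Fin 18) (d : ℤ × ℤ) (w : ℝ × ℝ) : ℝ × ℝ :=
  (D.earCell i j d).point ((1 - w.2) / 2 - w.1) ((1 - w.2) / 2 + w.1) w.2

lemma earLift_mem {i j : Fin 18} {d : ℤ × ℤ} {w : ℝ × ℝ} (hw : w ∈ Graph.earRegion) :
    D.earLift i j d w ∈ (D.earCell i j d).interior := by
  obtain ⟨h0, h1⟩ := hw
  obtain ⟨h2, h3⟩ := abs_lt.1 h1
  exact ⟨_, _, _, by linarith, by linarith, h0, by ring, rfl⟩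

lemma earLift_base (i j : Fin 18) (d : ℤ × ℤ) (x : ℝ) :
    D.earLift i j d (x, 0) = D.lift i (1 / 2 + x) := by
  simp only [earLift, lift, point, earCell, edgeCell]
  ext <;> simp only <;> ring

/-- The field `ne` says that the determinant of this affine map is nonzero; each coordinate is then
recovered by Cramer's rule. -/
lemma ValidEar.injective {i j : Fin 18} {d : ℤ × ℤ} (h : D.ValidEar i j d) :
    (D.earLift i j d).Injective := by
  rintro ⟨x, y⟩ ⟨x', y'⟩ hxy
  obtain ⟨h1, h2⟩ := Prod.ext_iff.1 hxy
  have hne := h.ne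
  simp only [earLift, point] at h1 h2
  generalize D.earCell i j d = T at h1 h2 hne
  simp only [form, normal] at hne
  have hne' : ((T.a.2 - T.b.2 : ℝ) * (T.c.1 - T.a.1) + (T.b.1 - T.a.1) * (T.c.2 - T.a.2)) ≠ 0 := by
    intro h0
    apply hne
    have : ((T.a.2 - T.b.2) * (T.c.1 - T.a.1) + (T.b.1 - T.a.1) * (T.c.2 - T.a.2)) = 0 := by
      exact_mod_cast h0
    linarith
  have hy : y = y' := by
    apply sub_eq_zero.1
    refine (mul_eq_zero.1 ?_).resolve_right hne'
    linear_combination (T.a.2 - T.b.2 : ℝ) * h1 + (T.b.1 - T.a.1 : ℝ) * h2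
  subst hy
  have hx : x = x' := by
    apply sub_eq_zero.1
    refine (mul_eq_zero.1 ?_).resolve_right hne'
    linear_combination (-(T.a.2 - T.c.2) : ℝ) * h1 + (-(T.c.1 - T.a.1) : ℝ) * h2
  rw [hx]

/-- A valid ear of a drawing is an ear of the embedding. -/
theorem ValidEar.isEar (hD : D.Valid) {i j : Fin 18} {d : ℤ × ℤ} (h : D.ValidEar i j d) :
    F12Graph.IsEar D.vertexPoint D.curve (F12Edge i) (F12Edge j)
      (fun w => proj D.N (D.earLift i j d w)) := by
  have base : ∀ x ∈ Ioo (-(1 / 2) : ℝ) (1 / 2), 1 / 2 + x ∈ Ioo (0 : ℝ) 1 := fun x hx =>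
    ⟨by linarith [hx.1], by linarith [hx.2]⟩
  refine ⟨?_, ?_, ?_, ?_, ?_, ?_⟩
  · unfold earLift point
    fun_prop
  · exact (injOn_proj hD.pos_N h.inBox h.self).comp h.injective.injOn fun w hw => earLift_mem hw
  · intro w hw
    refine ⟨fun x _ => proj_ne hD.pos_N h.inBox (hD.vertex_inBox x) (h.vertex x) (earLift_mem hw)
      (vertex_mem x), ?_⟩
    intro f _ _ hf
    obtain ⟨z, hz, hzw⟩ := openArc_edgeCurve _ hf
    exact proj_ne hD.pos_N h.inBox (hD.edge_inBox _) (h.edge _) (earLift_mem hw) hz hzw.symm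
  · intro x hx
    rw [curve, F12Index_edge, earLift_base]
    exact ⟨⟨1 / 2 + x, Ioo_subset_Icc_self (base x hx)⟩, base x hx, rfl⟩
  · intro x hx y hy hxy
    simp only [earLift_base] at hxy
    exact add_left_cancel (hD.injOn_proj_lift i (base x hx) (base y hy) hxy)
  · rw [curve, F12Index_edge]
    refine ⟨⟨1 / 2, by norm_num, by norm_num⟩, ⟨?_, ?_⟩, ?_⟩
    · rw [← Subtype.coe_lt_coe]; norm_num
    · rw [← Subtype.coe_lt_coe]; norm_num
    -- The apex is the midpoint of the edge `j` translated by `N • d`. The parity conditions make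
    -- the integer division in `earCell` exact.
    · refine (proj_eq_iff hD.pos_N).2 ⟨-d, ?_⟩
      obtain ⟨k, hk⟩ := h.even_fst
      obtain ⟨l, hl⟩ := h.even_snd
      have hk' : ((D.pos (F12Ends j).1).1 : ℝ) + (D.head j).1 = 2 * k := by exact_mod_cast hk
      have hl' : ((D.pos (F12Ends j).1).2 : ℝ) + (D.head j).2 = 2 * l := by exact_mod_cast hl
      simp only [earLift, lift, point, earCell, edgeCell, hk, hl, ne_eq, OfNat.ofNat_ne_zero,
        not_false_eq_true, Int.mul_ediv_cancel_left]
      ext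
      · push_cast
        simp only [Prod.fst_neg, Int.cast_neg]
        linear_combination (1 / 2 : ℝ) * hk'
      · push_cast
        simp only [Prod.snd_neg, Int.cast_neg]
        linear_combination (1 / 2 : ℝ) * hl'

end F12Drawing

/-! ### Two drawings and eighteen ears -/

namespace F12Drawing

open F12Vertex in
/-- A drawing with faces of lengths 4, 4, 6, 6, 8, 8. -/
def first : F12Drawing where
  N := 60
  pos
    | A => (0, 0) | A' => (-10, -10) | B => (24, -24) | B' => (14, 26)
    | v1 => (28, -8) | v2 => (-16, -4) | v3 => (-6, 6) | v4 => (-2, 22)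
    | v5 => (-14, -26) | v6 => (-30, -30) | v7 => (20, 20) | v8 => (16, 4)
  off := ![(0, 0), (0, 0), (0, 0), (0, -1), (1, 0), (0, 0), (0, 0), (-1, -1), (0, 0), (0, 0),
    (0, 0), (0, 0), (1, 0), (0, 0), (0, 0), (0, 0), (0, 1), (0, 0)]

open F12Vertex in
/-- A drawing with faces of lengths 5, 5, 5, 5, 8, 8. -/
def second : F12Drawing where
  N := 40
  pos
    | A => (0, 0) | A' => (4, -14) | B => (-16, 16) | B' => (20, 10)
    | v1 => (-8, 12) | v2 => (0, -24) | v3 => (4, 10) | v4 => (12, 14)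
    | v5 => (12, -18) | v6 => (20, -14) | v7 => (-16, 0) | v8 => (-8, 4)
  off := ![(0, 0), (0, 0), (0, 0), (-1, 0), (-1, 1), (1, 0), (0, -1), (1, 0), (0, 0), (0, 0),
    (0, 0), (0, 0), (0, 1), (0, 0), (0, 0), (0, 0), (0, 1), (0, 0)]

lemma valid_first : first.Valid := by
  constructor <;> decide +kernel

lemma valid_second : second.Valid := by
  constructor <;> decide +kernel

/-- The two drawings, the second one taken twice. -/
def drawing : Fin 3 → F12Drawing := ![first, second, second]

lemma valid_drawing (k : Fin 3) : (drawing k).Valid := by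
  fin_cases k
  exacts [valid_first, valid_second, valid_second]

/-- The number of a drawing, the base, the apex, and the translation of the apex of eighteen ears. -/
def ear : Fin 18 → Fin 3 × Fin 18 × Fin 18 × ℤ × ℤ :=
  -- The first fourteen entries follow the order of `F12Case`; in the last four, base and apex lie
  -- on edges with a common end.
  ![(0, 0, 3, 0, 0), (0, 0, 10, 0, 0), (1, 0, 4, 0, -1), (1, 0, 12, 0, -1), (0, 0, 6, 0, 0),
    (0, 0, 16, 0, -1), (1, 0, 14, 0, 0), (1, 0, 7, 0, 0), (0, 8, 9, 0, 0), (0, 8, 10, 0, 0),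
    (0, 8, 11, 0, 0), (1, 8, 12, 0, 0), (0, 8, 16, 0, -1), (0, 16, 17, -1, 0), (0, 0, 1, 0, 0),
    (0, 0, 8, 0, 0), (0, 8, 15, 0, 0), (0, 8, 17, 0, 0)]

lemma validEar_ear (m : Fin 18) :
    (drawing (ear m).1).ValidEar (ear m).2.1 (ear m).2.2.1 (ear m).2.2.2 := by
  revert m
  -- The structure is unfolded into a conjunction, for which decidability is inferred.
  suffices h : ∀ m : Fin 18, _ ∧ _ ∧ _ ∧ _ ∧ _ ∧ _ ∧ _ from fun m =>
    ⟨(h m).1, (h m).2.1, (h m).2.2.1, (h m).2.2.2.1, (h m).2.2.2.2.1, (h m).2.2.2.2.2.1,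
      (h m).2.2.2.2.2.2⟩
  decide +kernel

end F12Drawing

/-! ### Automorphisms and pairs of edges -/

namespace F12

open F12Vertex

/-- Exchange `A'` with `3`, `B'` with `6`, and `4` with `5`. -/
def swap₁ : F12Vertex → F12Vertex
  | A => A | A' => v3 | B => B | B' => v6 | v1 => v1 | v2 => v2
  | v3 => A' | v4 => v5 | v5 => v4 | v6 => B' | v7 => v7 | v8 => v8

/-- Exchange `A` with `A'`, `B` with `B'`, and `i` with `5 - i` modulo `8`. -/
def swap₂ : F12Vertex → F12Vertex
  | A => A' | A' => A | B => B' | B' => B | v1 => v4 | v2 => v3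
  | v3 => v2 | v4 => v1 | v5 => v8 | v6 => v7 | v7 => v6 | v8 => v5

/-- Exchange `A` with `B`, `A'` with `B'`, and `i` with `9 - i`. -/
def swap₃ : F12Vertex → F12Vertex
  | A => B | A' => B' | B => A | B' => A' | v1 => v8 | v2 => v7
  | v3 => v6 | v4 => v5 | v5 => v4 | v6 => v3 | v7 => v2 | v8 => v1

/-- Exchange `A` with `2`, `A'` with `3`, `B` with `7`, `B'` with `6`, `1` with `8`, `4` with `5`. -/
def swap₄ : F12Vertex → F12Vertex
  | A => v2 | A' => v3 | B => v7 | B' => v6 | v1 => v8 | v2 => A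
  | v3 => A' | v4 => v5 | v5 => v4 | v6 => B' | v7 => B | v8 => v1

/-- The action of `swap₁` on the edges. -/
def swapEdge₁ : Fin 18 → Fin 18 := ![1, 0, 6, 4, 3, 7, 2, 5, 8, 13, 10, 14, 12, 9, 11, 15, 16, 17]

/-- The action of `swap₂` on the edges. -/
def swapEdge₂ : Fin 18 → Fin 18 := ![0, 2, 1, 3, 5, 4, 6, 7, 9, 8, 11, 10, 13, 12, 15, 14, 17, 16]

/-- The action of `swap₃` on the edges. -/
def swapEdge₃ : Fin 18 → Fin 18 := ![3, 4, 5, 0, 1, 2, 7, 6, 10, 11, 8, 9, 15, 14, 13, 12, 16, 17]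

/-- The action of `swap₄` on the edges. -/
def swapEdge₄ : Fin 18 → Fin 18 := ![6, 2, 1, 7, 5, 4, 0, 3, 12, 13, 15, 14, 8, 9, 11, 10, 16, 17]

/-- The action of sixteen automorphisms on the edges. -/
def autEdge (b : Fin 4 → Bool) (i : Fin 18) : Fin 18 :=
  let i₄ := bif b 3 then swapEdge₄ i else i
  let i₃ := bif b 2 then swapEdge₃ i₄ else i₄
  let i₂ := bif b 1 then swapEdge₂ i₃ else i₃
  bif b 0 then swapEdge₁ i₂ else i₂

/-- An involution of the vertices that maps edges to edges is an automorphism. -/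
lemma exists_iso_of_involution {g : F12Vertex → F12Vertex} {gE : Fin 18 → Fin 18}
    (hg : ∀ x, g (g x) = x) (h : ∀ i, (F12Edge i).map g = F12Edge (gE i)) (b : Bool) :
    ∃ τ : F12 ≃g F12, ∀ i, (F12Edge i).map τ = F12Edge (bif b then gE i else i) := by
  have hadj : ∀ x y, F12.Adj x y → F12.Adj (g x) (g y) := by
    intro x y hxy
    obtain ⟨i, hi⟩ := F12_adj.1 hxy
    exact F12_adj.2 ⟨gE i, by rw [← h, hi, Sym2.map_mk]⟩
  cases b
  · exact ⟨RelIso.refl _, fun i => congrFun Sym2.map_id (F12Edge i)⟩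
  · refine ⟨⟨Function.Involutive.toPerm g hg, fun {x y} => ⟨fun hxy => ?_, hadj x y⟩⟩, h⟩
    have := hadj (g x) (g y) hxy
    rwa [hg, hg] at this

/-- The four switches select the involutions to compose; as in `autEdge`, the fourth acts first. -/
lemma exists_aut (b : Fin 4 → Bool) :
    ∃ τ : F12 ≃g F12, ∀ i, (F12Edge i).map τ = F12Edge (autEdge b i) := by
  obtain ⟨τ₁, h₁⟩ := exists_iso_of_involution (g := swap₁) (gE := swapEdge₁)
    (by decide +kernel) (by decide +kernel) (b 0)
  obtain ⟨τ₂, h₂⟩ := exists_iso_of_involution (g := swap₂) (gE := swapEdge₂)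
    (by decide +kernel) (by decide +kernel) (b 1)
  obtain ⟨τ₃, h₃⟩ := exists_iso_of_involution (g := swap₃) (gE := swapEdge₃)
    (by decide +kernel) (by decide +kernel) (b 2)
  obtain ⟨τ₄, h₄⟩ := exists_iso_of_involution (g := swap₄) (gE := swapEdge₄)
    (by decide +kernel) (by decide +kernel) (b 3)
  refine ⟨((τ₄.trans τ₃).trans τ₂).trans τ₁, fun i => ?_⟩
  have e : (⇑(((τ₄.trans τ₃).trans τ₂).trans τ₁) : F12Vertex → F12Vertex) =
    τ₁ ∘ τ₂ ∘ τ₃ ∘ τ₄ := rfl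
  rw [e, Sym2.map_comp, Sym2.map_comp, Sym2.map_comp]
  simp only [Function.comp_apply, h₁, h₂, h₃, h₄, autEdge]

/-- Two edges have a common end. -/
def Meet (i j : Fin 18) : Prop :=
  (F12Ends i).1 = (F12Ends j).1 ∨ (F12Ends i).1 = (F12Ends j).2 ∨
    (F12Ends i).2 = (F12Ends j).1 ∨ (F12Ends i).2 = (F12Ends j).2

instance (i j : Fin 18) : Decidable (Meet i j) := by unfold Meet; infer_instance

open F12Drawing in
/-- Every pair of edges is equivalent to the base and the apex of an ear. -/
lemma exists_autEdge_pair : ∀ i j : Fin 18, i ≠ j → ∃ (b : Fin 4 → Bool) (m : Fin 18),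
    (autEdge b i = (ear m).2.1 ∧ autEdge b j = (ear m).2.2.1 ∨
      autEdge b j = (ear m).2.1 ∧ autEdge b i = (ear m).2.2.1) ∧ (14 ≤ m → Meet i j) := by
  decide +kernel

open F12Drawing in
/-- Every edge is equivalent to the base of an ear. -/
lemma exists_autEdge_base : ∀ i : Fin 18, ∃ (b : Fin 4 → Bool) (m : Fin 18),
    autEdge b i = (ear m).2.1 := by
  decide +kernel

/-! ### Walk counts as invariants of pairs of edges -/

/-- The neighbours of a vertex. -/
def nbrs : F12Vertex → List F12Vertex
  | A => [A', v3, v8] | A' => [A, v2, v5] | B => [B', v6, v1] | B' => [B, v7, v4]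
  | v1 => [B, v2, v8] | v2 => [A', v3, v1] | v3 => [A, v2, v4] | v4 => [B', v3, v5]
  | v5 => [A', v6, v4] | v6 => [B, v7, v5] | v7 => [B', v6, v8] | v8 => [A, v7, v1]

lemma mem_nbrs : ∀ x y, y ∈ nbrs x ↔ F12.Adj x y := by decide +kernel

lemma nodup_nbrs : ∀ x, (nbrs x).Nodup := by decide +kernel

/-- The number of walks of length `n` from `x` to `y`. -/
def walks : ℕ → F12Vertex → F12Vertex → ℕ
  | 0, x, y => if x = y then 1 else 0
  | n + 1, x, y => ((nbrs x).map fun z => walks n z y).sum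

/-- An automorphism maps the neighbours of `x` bijectively onto those of `τ x`, so the recursion
sums the same terms in another order. This holds for arbitrary automorphisms, not only for the
explicit ones. -/
lemma walks_apply (τ : F12 ≃g F12) (n : ℕ) (x y : F12Vertex) :
    walks n (τ x) (τ y) = walks n x y := by
  induction n generalizing x with
  | zero => simp [walks]
  | succ n ih =>
    have hp : (nbrs (τ x)).Perm ((nbrs x).map τ) := by
      rw [List.perm_ext_iff_of_nodup (nodup_nbrs _) ((nodup_nbrs x).map τ.injective)]
      intro z
      rw [mem_nbrs, List.mem_map]
      constructor
      · intro h
        refine ⟨τ.symm z, (mem_nbrs _ _).2 ?_, by simp⟩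
        rw [← τ.map_adj_iff]
        simpa using h
      · rintro ⟨w, hw, rfl⟩
        exact τ.map_adj_iff.2 ((mem_nbrs _ _).1 hw)
    rw [walks, walks, (hp.map _).sum_eq, List.map_map]
    congr 2
    funext z
    exact ih z

/-- The number of walks of length `n` between an end of one edge and an end of another one, and back. -/
def crossWalks (n : ℕ) (x₁ y₁ x₂ y₂ : F12Vertex) : ℕ :=
  walks n x₁ x₂ + walks n x₁ y₂ + walks n y₁ x₂ + walks n y₁ y₂ +
    (walks n x₂ x₁ + walks n y₂ x₁ + walks n x₂ y₁ + walks n y₂ y₁)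

/-- The number of walks of length `n` between the ends of each of two edges. -/
def ownWalks (n : ℕ) (x₁ y₁ x₂ y₂ : F12Vertex) : ℕ :=
  walks n x₁ y₁ + walks n y₁ x₁ + (walks n x₂ y₂ + walks n y₂ x₂)

/-- Numbers that distinguish the orbits of pairs of disjoint edges. -/
def invariants (x₁ y₁ x₂ y₂ : F12Vertex) : ℕ × ℕ × ℕ :=
  (crossWalks 2 x₁ y₁ x₂ y₂, crossWalks 5 x₁ y₁ x₂ y₂, ownWalks 5 x₁ y₁ x₂ y₂)

/-- There are eight ways to write the same pair of edges. Walks are counted in both directions, so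
each rewriting only permutes summands and symmetry of `walks` is not needed. -/
lemma invariants_eq_of_eq {a b c d a' b' c' d' : F12Vertex}
    (h : s(s(a, b), s(c, d)) = s(s(a', b'), s(c', d'))) :
    invariants a b c d = invariants a' b' c' d' := by
  simp only [invariants, crossWalks, ownWalks, Prod.mk.injEq]
  simp only [Sym2.eq_iff] at h
  rcases h with ⟨⟨rfl, rfl⟩ | ⟨rfl, rfl⟩, ⟨rfl, rfl⟩ | ⟨rfl, rfl⟩⟩ |
    ⟨⟨rfl, rfl⟩ | ⟨rfl, rfl⟩, ⟨rfl, rfl⟩ | ⟨rfl, rfl⟩⟩ <;> refine ⟨?_, ?_, ?_⟩ <;> ring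

lemma invariants_eq_of_sameCase {i : Fin 14} {x₁ y₁ x₂ y₂ : F12Vertex}
    (h : F12SameCase i x₁ y₁ x₂ y₂) :
    invariants x₁ y₁ x₂ y₂ = invariants (F12Case i).1.1 (F12Case i).1.2 (F12Case i).2.1
      (F12Case i).2.2 := by
  obtain ⟨τ, hτ⟩ := h
  rw [← invariants_eq_of_eq hτ]
  simp only [invariants, crossWalks, ownWalks, walks_apply]

lemma invariants_injective : ∀ i j : Fin 14,
    invariants (F12Case i).1.1 (F12Case i).1.2 (F12Case i).2.1 (F12Case i).2.2 =
      invariants (F12Case j).1.1 (F12Case j).1.2 (F12Case j).2.1 (F12Case j).2.2 → i = j := by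
  decide +kernel

end F12

/-! ### Girth -/

/-- Cycles of a simple graph have length at least three, and those of length three are the
3-cliques. -/
lemma SimpleGraph.four_le_egirth_iff {V : Type*} {G : SimpleGraph V} :
    4 ≤ G.egirth ↔ ∀ a b c, G.Adj a b → G.Adj b c → ¬ G.Adj a c := by
  classical
  constructor
  · intro h a b c hab hbc hac
    obtain ⟨u, w, hw, hl⟩ := G.is3Clique_iff_exists_cycle_length_three.1
      ⟨{a, b, c}, is3Clique_triple_iff.2 ⟨hab, hac, hbc⟩⟩
    have := h.trans (egirth_le_length hw)
    rw [hl] at this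
    exact absurd this (by decide)
  · intro h
    rw [le_egirth]
    intro u w hw
    have h3 := hw.three_le_length
    have hne : w.length ≠ 3 := by
      intro h3
      obtain ⟨s, hs⟩ := G.is3Clique_iff_exists_cycle_length_three.2 ⟨u, w, hw, h3⟩
      obtain ⟨a, b, c, hab, hac, hbc, -⟩ := is3Clique_iff.1 hs
      exact h a b c hab hbc hac
    have : 4 ≤ w.length := by omega
    exact_mod_cast this

namespace Graph

variable {α β : Type*} {G : Graph α β} {e e₁ e₂ : β} {x y x₁ y₁ x₂ y₂ : α}

/-- The new loop already violates simplicity. -/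
lemma not_girthGeFour_addLoop : ¬ (G.addLoop e x y).GirthGeFour := by
  rintro ⟨h, -⟩
  exact h.not_isLoopAt (Sum.inr 3) (Sum.inr 1) ⟨rfl, Or.inr ⟨1, rfl⟩, Or.inr ⟨1, rfl⟩⟩

lemma not_girthGeFour_addParallel : ¬ (G.addParallel e x y).GirthGeFour := by
  rintro ⟨h, -⟩
  have := h.eq_of_isLink (e := Sum.inr 1) (f := Sum.inr 3) (x := Sum.inr 0) (y := Sum.inr 1)
    ⟨rfl, Or.inr ⟨0, rfl⟩, Or.inr ⟨1, rfl⟩⟩ ⟨rfl, Or.inr ⟨0, rfl⟩, Or.inr ⟨1, rfl⟩⟩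
  simp at this

lemma addChord_isLink_inr {i : Fin 5} {a b : α ⊕ Fin 2} :
    (G.addChord e₁ x₁ y₁ e₂ x₂ y₂).IsLink (Sum.inr i) a b ↔
      ![s(Sum.inl x₁, Sum.inr 0), s(Sum.inr 0, Sum.inl y₁), s(Sum.inl x₂, Sum.inr 1),
        s(Sum.inr 1, Sum.inl y₂), s(Sum.inr 0, Sum.inr 1)] i = s(a, b) ∧
      a ∈ Sum.inl '' G.vertexSet ∪ Set.range Sum.inr ∧
      b ∈ Sum.inl '' G.vertexSet ∪ Set.range Sum.inr := Iff.rfl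

lemma addChord_isLink_inl {f : β} {a b : α ⊕ Fin 2} :
    (G.addChord e₁ x₁ y₁ e₂ x₂ y₂).IsLink (Sum.inl f) a b ↔
      f ∉ ({e₁, e₂} : Set β) ∧ ∃ c d, G.IsLink f c d ∧ a = Sum.inl c ∧ b = Sum.inl d := Iff.rfl

lemma addChord_adj_inl_inl {a b : α} (h : (G.addChord e₁ x₁ y₁ e₂ x₂ y₂).Adj (.inl a) (.inl b)) :
    ∃ f, f ≠ e₁ ∧ f ≠ e₂ ∧ G.IsLink f a b := by
  obtain ⟨f | i, h⟩ := h
  · obtain ⟨hD, c, d, hl, hc, hd⟩ := addChord_isLink_inl.1 h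
    cases hc
    cases hd
    exact ⟨f, fun h => hD (by simp [h]), fun h => hD (by simp [h]), hl⟩
  · obtain ⟨h, -⟩ := addChord_isLink_inr.1 h
    fin_cases i <;> simp at h

lemma addChord_adj_inl_zero {a : α} (h : (G.addChord e₁ x₁ y₁ e₂ x₂ y₂).Adj (.inl a) (.inr 0)) :
    a = x₁ ∨ a = y₁ := by
  obtain ⟨f | i, h⟩ := h
  · obtain ⟨hD, c, d, hl, hc, hd⟩ := addChord_isLink_inl.1 h
    cases hd
  · obtain ⟨h, -⟩ := addChord_isLink_inr.1 h
    fin_cases i <;> simp at h <;> simp [h]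

lemma addChord_adj_inl_one {a : α} (h : (G.addChord e₁ x₁ y₁ e₂ x₂ y₂).Adj (.inl a) (.inr 1)) :
    a = x₂ ∨ a = y₂ := by
  obtain ⟨f | i, h⟩ := h
  · obtain ⟨hD, c, d, hl, hc, hd⟩ := addChord_isLink_inl.1 h
    cases hd
  · obtain ⟨h, -⟩ := addChord_isLink_inr.1 h
    fin_cases i <;> simp at h <;> simp [h]

/-- With `x₁ = y₁` or `x₂ = y₂`, the two halves of the subdivided edge would be parallel. -/
lemma addChord_simple [G.Simple] (h₁ : x₁ ≠ y₁) (h₂ : x₂ ≠ y₂) :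
    (G.addChord e₁ x₁ y₁ e₂ x₂ y₂).Simple where
  not_isLoopAt := by
    rintro (f | i) a h
    · obtain ⟨-, c, d, hl, rfl, hd⟩ := addChord_isLink_inl.1 h
      exact hl.ne (Sum.inl.inj hd)
    · obtain ⟨h, -⟩ := addChord_isLink_inr.1 h
      fin_cases i <;> simp at h <;> grind
  eq_of_isLink := by
    rintro (f | i) (g | j) a b h h'
    · obtain ⟨-, c, d, hl, rfl, rfl⟩ := addChord_isLink_inl.1 h
      obtain ⟨-, c, d, hl', hc, hd⟩ := addChord_isLink_inl.1 h'
      cases hc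
      cases hd
      rw [hl.eq hl']
    · obtain ⟨-, c, d, hl, rfl, rfl⟩ := addChord_isLink_inl.1 h
      obtain ⟨h', -⟩ := addChord_isLink_inr.1 h'
      fin_cases j <;> simp at h'
    · obtain ⟨-, c, d, hl, rfl, rfl⟩ := addChord_isLink_inl.1 h'
      obtain ⟨h, -⟩ := addChord_isLink_inr.1 h
      fin_cases i <;> simp at h
    · obtain ⟨h, -⟩ := addChord_isLink_inr.1 h
      obtain ⟨h', -⟩ := addChord_isLink_inr.1 h'
      rw [← h'] at h
      fin_cases i <;> fin_cases j <;> simp at h <;> first | rfl | grind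

/-- A chord between disjoint edges of a simple graph without triangles creates no triangle. -/
theorem girthGeFour_addChord [G.Simple] (htri : ∀ a b c, G.Adj a b → G.Adj b c → ¬ G.Adj a c)
    (h₁ : G.IsLink e₁ x₁ y₁) (h₂ : G.IsLink e₂ x₂ y₂)
    (hxx : x₁ ≠ x₂) (hxy : x₁ ≠ y₂) (hyx : y₁ ≠ x₂) (hyy : y₁ ≠ y₂) :
    (G.addChord e₁ x₁ y₁ e₂ x₂ y₂).GirthGeFour := by
  have hs := addChord_simple (G := G) (e₁ := e₁) (e₂ := e₂) h₁.ne h₂.ne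
  refine ⟨hs, SimpleGraph.four_le_egirth_iff.2 ?_⟩
  have key : ∀ a b c, (G.addChord e₁ x₁ y₁ e₂ x₂ y₂).Adj a b →
      (G.addChord e₁ x₁ y₁ e₂ x₂ y₂).Adj b c → ¬ (G.addChord e₁ x₁ y₁ e₂ x₂ y₂).Adj a c := by
    -- A triangle through `u` and two old vertices would need an edge between the ends of `e₁` other
    -- than `e₁`, against simplicity of `G`.
    have hu : ∀ a b, (G.addChord e₁ x₁ y₁ e₂ x₂ y₂).Adj (.inl a) (.inl b) →
        (G.addChord e₁ x₁ y₁ e₂ x₂ y₂).Adj (.inl a) (.inr 0) →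
        ¬ (G.addChord e₁ x₁ y₁ e₂ x₂ y₂).Adj (.inl b) (.inr 0) := by
      intro a b hab ha hb
      obtain ⟨f, hf, -, hl⟩ := addChord_adj_inl_inl hab
      rcases addChord_adj_inl_zero ha with rfl | rfl <;>
        rcases addChord_adj_inl_zero hb with rfl | rfl
      · exact hl.ne rfl
      · exact hf (hl.eq h₁)
      · exact hf (hl.eq h₁.symm)
      · exact hl.ne rfl
    have hv : ∀ a b, (G.addChord e₁ x₁ y₁ e₂ x₂ y₂).Adj (.inl a) (.inl b) →
        (G.addChord e₁ x₁ y₁ e₂ x₂ y₂).Adj (.inl a) (.inr 1) →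
        ¬ (G.addChord e₁ x₁ y₁ e₂ x₂ y₂).Adj (.inl b) (.inr 1) := by
      intro a b hab ha hb
      obtain ⟨f, -, hf, hl⟩ := addChord_adj_inl_inl hab
      rcases addChord_adj_inl_one ha with rfl | rfl <;>
        rcases addChord_adj_inl_one hb with rfl | rfl
      · exact hl.ne rfl
      · exact hf (hl.eq h₂)
      · exact hf (hl.eq h₂.symm)
      · exact hl.ne rfl
    -- An old vertex adjacent to both `u` and `v` would be a common end of the two subdivided edges.
    have huv : ∀ a, (G.addChord e₁ x₁ y₁ e₂ x₂ y₂).Adj (.inl a) (.inr 0) →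
        ¬ (G.addChord e₁ x₁ y₁ e₂ x₂ y₂).Adj (.inl a) (.inr 1) := by
      intro a ha hb
      rcases addChord_adj_inl_zero ha with rfl | rfl <;>
        rcases addChord_adj_inl_one hb with h | h <;> contradiction
    have hl : ∀ a, ¬ (G.addChord e₁ x₁ y₁ e₂ x₂ y₂).Adj a a := not_adj_self _
    rintro (a | i) (b | j) (c | k) hab hbc hac
    · obtain ⟨f, -, -, hf⟩ := addChord_adj_inl_inl hab
      obtain ⟨g, -, -, hg⟩ := addChord_adj_inl_inl hbc
      obtain ⟨k, -, -, hk⟩ := addChord_adj_inl_inl hac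
      exact htri a b c hf.adj hg.adj hk.adj
    · fin_cases k
      exacts [hu a b hab hac hbc, hv a b hab hac hbc]
    · fin_cases j
      exacts [hu a c hac hab hbc.symm, hv a c hac hab hbc.symm]
    · fin_cases j <;> fin_cases k
      exacts [hl _ hbc, huv a hab hac, huv a hac hab, hl _ hbc]
    · fin_cases i
      exacts [hu b c hbc hab.symm hac.symm, hv b c hbc hab.symm hac.symm]
    · fin_cases i <;> fin_cases k
      exacts [hl _ hac, huv b hab.symm hbc, huv b hbc hab.symm, hl _ hac]
    · fin_cases i <;> fin_cases j
      exacts [hl _ hab, huv c hac.symm hbc.symm, huv c hbc.symm hac.symm, hl _ hab]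
    · fin_cases i <;> fin_cases j <;> fin_cases k <;>
        first | exact hl _ hab | exact hl _ hbc | exact hl _ hac
  exact fun a b c hab hbc hac => key a b c hab.2 hbc.2 hac.2

/-- A chord between edges with a common end creates a triangle. -/
theorem not_girthGeFour_addChord (h₁ : G.IsLink e₁ x₁ y₁) {z : α} (hz₁ : z = x₁ ∨ z = y₁)
    (hz₂ : z = x₂ ∨ z = y₂) : ¬ (G.addChord e₁ x₁ y₁ e₂ x₂ y₂).GirthGeFour := by
  rintro ⟨-, h⟩
  have hz : z ∈ G.vertexSet := by
    rcases hz₁ with rfl | rfl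
    exacts [h₁.left_mem, h₁.right_mem]
  have hV : Sum.inl z ∈ (G.addChord e₁ x₁ y₁ e₂ x₂ y₂).vertexSet := Or.inl ⟨z, hz, rfl⟩
  have hVr : ∀ i, Sum.inr i ∈ (G.addChord e₁ x₁ y₁ e₂ x₂ y₂).vertexSet := fun i => Or.inr ⟨i, rfl⟩
  have hu : (G.addChord e₁ x₁ y₁ e₂ x₂ y₂).Adj (.inl z) (.inr 0) := by
    rcases hz₁ with rfl | rfl
    exacts [⟨.inr 0, addChord_isLink_inr.2 ⟨rfl, hV, hVr 0⟩⟩,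
      ⟨.inr 1, addChord_isLink_inr.2 ⟨Sym2.eq_swap, hV, hVr 0⟩⟩]
  have hv : (G.addChord e₁ x₁ y₁ e₂ x₂ y₂).Adj (.inl z) (.inr 1) := by
    rcases hz₂ with rfl | rfl
    exacts [⟨.inr 2, addChord_isLink_inr.2 ⟨rfl, hV, hVr 1⟩⟩,
      ⟨.inr 3, addChord_isLink_inr.2 ⟨Sym2.eq_swap, hV, hVr 1⟩⟩]
  have huv : (G.addChord e₁ x₁ y₁ e₂ x₂ y₂).Adj (.inr 0) (.inr 1) :=
    ⟨.inr 4, addChord_isLink_inr.2 ⟨rfl, hVr 0, hVr 1⟩⟩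
  exact SimpleGraph.four_le_egirth_iff.1 h ⟨_, hV⟩ ⟨_, hVr 0⟩ ⟨_, hVr 1⟩
    ⟨by simp, hu⟩ ⟨by simp, huv⟩ ⟨by simp, hv⟩

end Graph

/-! ### The additions to `F₁₂` -/

open F12Drawing

lemma F12_simple : F12Graph.Simple where
  not_isLoopAt _ _ h := (F12Graph_isLink.1 h).2.ne rfl
  eq_of_isLink _ _ _ _ h h' := (F12Graph_isLink.1 h).1.trans (F12Graph_isLink.1 h').1.symm

lemma F12_triangleFree : ∀ a b c, F12.Adj a b → F12.Adj b c → ¬ F12.Adj a c := by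
  have : ∀ a, ∀ b ∈ F12.nbrs a, ∀ c ∈ F12.nbrs b, c ∉ F12.nbrs a := by decide +kernel
  simp only [F12.mem_nbrs] at this
  exact fun a b c hab hbc => this a b hab c hbc

lemma F12Graph_isLink_map (τ : F12 ≃g F12) (e : Sym2 F12Vertex) (x y : F12Vertex)
    (h : F12Graph.IsLink e x y) : F12Graph.IsLink (e.map τ) (τ x) (τ y) := by
  obtain ⟨rfl, h'⟩ := F12Graph_isLink.1 h
  exact F12Graph_isLink.2 ⟨rfl, τ.map_adj_iff.2 h'⟩

/-- The base and the apex of the first fourteen ears are the listed pairs of edges. -/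
lemma ear_eq_case : ∀ m : Fin 18, ∀ h : m.val < 14,
    F12Edge (ear m).2.1 = s((F12Case ⟨m, h⟩).1.1, (F12Case ⟨m, h⟩).1.2) ∧
    F12Edge (ear m).2.2.1 = s((F12Case ⟨m, h⟩).2.1, (F12Case ⟨m, h⟩).2.2) := by
  decide +kernel

lemma F12Case_disjoint : ∀ i : Fin 14,
    (F12Case i).1.1 ≠ (F12Case i).2.1 ∧ (F12Case i).1.1 ≠ (F12Case i).2.2 ∧
      (F12Case i).1.2 ≠ (F12Case i).2.1 ∧ (F12Case i).1.2 ≠ (F12Case i).2.2 := by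
  decide +kernel

lemma F12Case_adj (i : Fin 14) : F12.Adj (F12Case i).1.1 (F12Case i).1.2 ∧
    F12.Adj (F12Case i).2.1 (F12Case i).2.2 := by
  obtain ⟨h₁, h₂⟩ := ear_eq_case ⟨i, by omega⟩ i.2
  exact ⟨F12_adj.2 ⟨_, h₁⟩, F12_adj.2 ⟨_, h₂⟩⟩

/-- Every pair of distinct edges is joined by a chord of an embedding on the torus. -/
lemma F12_exists_isChord {e f : Sym2 F12Vertex} (he : e ∈ F12Graph.edgeSet)
    (hf : f ∈ F12Graph.edgeSet) (hne : e ≠ f) :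
    ∃ (p : F12Vertex → Graph.Torus) (γ : Sym2 F12Vertex → C(unitInterval, Graph.Torus)),
      F12Graph.IsEmbedding p γ ∧ ∃ χ, F12Graph.IsChord p γ e f χ := by
  obtain ⟨i, rfl⟩ := F12Graph_mem_edgeSet.1 he
  obtain ⟨j, rfl⟩ := F12Graph_mem_edgeSet.1 hf
  obtain ⟨b, m, hm, -⟩ := F12.exists_autEdge_pair i j fun h => hne (congrArg _ h)
  obtain ⟨τ, hτ⟩ := F12.exists_aut b
  have hear := (validEar_ear m).isEar (valid_drawing _)
  have hemb := (valid_drawing (ear m).1).isEmbedding.comp τ.injective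
    (Sym2.map.injective τ.injective) (fun _ _ => trivial) (F12Graph_isLink_map τ)
  refine ⟨_, _, hemb, ?_⟩
  rcases hm with ⟨h₁, h₂⟩ | ⟨h₁, h₂⟩
  all_goals
    -- Base and apex are written as images under `τ`, so that the ear can be pulled back. If the two
    -- edges occur in the other order, the resulting chord is reversed.
    rw [← h₁, ← h₂, ← hτ, ← hτ] at hear
    obtain ⟨χ, hχ⟩ := (hear.comp (fun _ _ => trivial) (F12Graph_isLink_map τ)).exists_isChord
  exacts [⟨χ, hχ⟩, ⟨_, hχ.reverse⟩]

/-- Every edge is the base of an ear of an embedding on the torus. -/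
lemma F12_exists_isEar {e : Sym2 F12Vertex} (he : e ∈ F12Graph.edgeSet) :
    ∃ (p : F12Vertex → Graph.Torus) (γ : Sym2 F12Vertex → C(unitInterval, Graph.Torus)),
      F12Graph.IsEmbedding p γ ∧ ∃ f z, F12Graph.IsEar p γ e f z := by
  obtain ⟨i, rfl⟩ := F12Graph_mem_edgeSet.1 he
  obtain ⟨b, m, hm⟩ := F12.exists_autEdge_base i
  obtain ⟨τ, hτ⟩ := F12.exists_aut b
  have hear := (validEar_ear m).isEar (valid_drawing _)
  have hemb := (valid_drawing (ear m).1).isEmbedding.comp τ.injective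
    (Sym2.map.injective τ.injective) (fun _ _ => trivial) (F12Graph_isLink_map τ)
  obtain ⟨f, hf⟩ : ∃ f : Sym2 F12Vertex, f.map τ = F12Edge (ear m).2.2.1 := by
    refine ⟨(F12Edge (ear m).2.2.1).map τ.symm, ?_⟩
    simp [Sym2.map_map]
  rw [← hm, ← hτ, ← hf] at hear
  exact ⟨_, _, hemb, f, _, hear.comp (fun _ _ => trivial) (F12Graph_isLink_map τ)⟩

theorem F12_isToroidal_of_isOneEdgeAddition {n : ℕ}
    {H : Graph (F12Vertex ⊕ Fin 2) (Sym2 F12Vertex ⊕ Fin n)} (h : F12Graph.IsOneEdgeAddition H) :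
    H.IsToroidal := by
  cases h with
  | loop e x y hl =>
    obtain ⟨p, γ, hemb, f, z, hz⟩ := F12_exists_isEar hl.edge_mem
    exact hz.exists_addLoop hemb hl
  | parallel e x y hl =>
    obtain ⟨p, γ, hemb, f, z, hz⟩ := F12_exists_isEar hl.edge_mem
    obtain ⟨χ, hχ, hne⟩ := hz.exists_isChord_self
    exact hemb.exists_addParallel hl hχ hne
  | chord e₁ e₂ x₁ y₁ x₂ y₂ h₁ h₂ hne =>
    obtain ⟨p, γ, hemb, χ, hχ⟩ := F12_exists_isChord h₁.edge_mem h₂.edge_mem hne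
    obtain ⟨q, δ, h, -⟩ := hemb.exists_extendsToChord h₁ h₂ hne hχ
    exact ⟨q, δ, h⟩

theorem F12_existsUnique_sameCase {x₁ y₁ x₂ y₂ : F12Vertex} (h₁ : F12.Adj x₁ y₁)
    (h₂ : F12.Adj x₂ y₂) (hne : s(x₁, y₁) ≠ s(x₂, y₂))
    (hg : (F12Chord x₁ y₁ x₂ y₂).GirthGeFour) : ∃! i : Fin 14, F12SameCase i x₁ y₁ x₂ y₂ := by
  obtain ⟨i, hi⟩ := F12_adj.1 h₁
  obtain ⟨j, hj⟩ := F12_adj.1 h₂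
  obtain ⟨b, m, hm, hmeet⟩ := F12.exists_autEdge_pair i j fun h => hne (by rw [← hi, ← hj, h])
  obtain ⟨τ, hτ⟩ := F12.exists_aut b
  -- The last four ears belong to pairs of edges with a common end, where the chord closes a
  -- triangle.
  have hm14 : m.val < 14 := by
    by_contra hm14
    obtain ⟨z, hz₁, hz₂⟩ : ∃ z, z ∈ F12Edge i ∧ z ∈ F12Edge j := by
      simp only [F12Edge, Sym2.mem_iff]
      rcases hmeet (Fin.le_def.2 (not_lt.1 hm14)) with h | h | h | h
      exacts [⟨_, .inl rfl, .inl h⟩, ⟨_, .inl rfl, .inr h⟩, ⟨_, .inr rfl, .inl h⟩,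
        ⟨_, .inr rfl, .inr h⟩]
    rw [hi, Sym2.mem_iff] at hz₁
    rw [hj, Sym2.mem_iff] at hz₂
    exact Graph.not_girthGeFour_addChord (F12Graph_isLink.2 ⟨rfl, h₁⟩) hz₁ hz₂ hg
  have hm' : F12SameCase ⟨m, hm14⟩ x₁ y₁ x₂ y₂ := by
    refine ⟨τ, ?_⟩
    obtain ⟨hb, ha⟩ := ear_eq_case m hm14
    rw [← hb, ← ha, ← Sym2.map_mk, ← Sym2.map_mk, ← hi, ← hj, hτ, hτ]
    rcases hm with ⟨h, h'⟩ | ⟨h, h'⟩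
    · rw [h, h']
    · rw [h, h', Sym2.eq_swap]
  refine ⟨_, hm', fun k hk => F12.invariants_injective _ _ ?_⟩
  exact (F12.invariants_eq_of_sameCase hk).symm.trans (F12.invariants_eq_of_sameCase hm')

/-- (1) Every one-edge addition `F₁₂ ∪ e` embeds into the torus.
(2) The additions of girth at least four fall, up to automorphisms of `F₁₂`, into exactly the
fourteen listed cases; no addition of the first two kinds has girth at least four.
(3) There are three embeddings of `F₁₂` into the torus such that in each of the fourteen cases one
of them extends to an embedding of `F₁₂ ∪ e`. -/
theorem mainTheorem7 :
    (∀ (n : ℕ) (H : Graph (F12Vertex ⊕ Fin 2) (Sym2 F12Vertex ⊕ Fin n)),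
      F12Graph.IsOneEdgeAddition H → H.IsToroidal) ∧
    ((∀ x y : F12Vertex, F12.Adj x y →
        ¬ (F12Graph.addLoop s(x, y) x y).GirthGeFour ∧
        ¬ (F12Graph.addParallel s(x, y) x y).GirthGeFour) ∧
      (∀ x₁ y₁ x₂ y₂ : F12Vertex, F12.Adj x₁ y₁ → F12.Adj x₂ y₂ → s(x₁, y₁) ≠ s(x₂, y₂) →
        (F12Chord x₁ y₁ x₂ y₂).GirthGeFour → ∃! i : Fin 14, F12SameCase i x₁ y₁ x₂ y₂) ∧
      (∀ i : Fin 14,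
        (F12Chord (F12Case i).1.1 (F12Case i).1.2 (F12Case i).2.1 (F12Case i).2.2).GirthGeFour)) ∧
    (∃ (p : Fin 3 → F12Vertex → Graph.Torus)
       (γ : Fin 3 → Sym2 F12Vertex → C(unitInterval, Graph.Torus)),
      (∀ k, F12Graph.IsEmbedding (p k) (γ k)) ∧
      ∀ i : Fin 14, ∃ k : Fin 3,
        ∃ (q : F12Vertex ⊕ Fin 2 → Graph.Torus)
          (δ : Sym2 F12Vertex ⊕ Fin 5 → C(unitInterval, Graph.Torus)),
          (F12Chord (F12Case i).1.1 (F12Case i).1.2 (F12Case i).2.1 (F12Case i).2.2).IsEmbedding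
            q δ ∧
          F12Graph.ExtendsToChord s((F12Case i).1.1, (F12Case i).1.2)
            s((F12Case i).2.1, (F12Case i).2.2) (p k) (γ k) q δ) := by
  refine ⟨fun n H => F12_isToroidal_of_isOneEdgeAddition,
    ⟨fun x y _ => ⟨Graph.not_girthGeFour_addLoop, Graph.not_girthGeFour_addParallel⟩,
      fun x₁ y₁ x₂ y₂ => F12_existsUnique_sameCase, fun i => ?_⟩,
    fun k => (drawing k).vertexPoint, fun k => (drawing k).curve,
    fun k => (valid_drawing k).isEmbedding, fun i => ?_⟩
  · have := F12_simple
    obtain ⟨h₁, h₂⟩ := F12Case_adj i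
    obtain ⟨hxx, hxy, hyx, hyy⟩ := F12Case_disjoint i
    refine Graph.girthGeFour_addChord ?_ (F12Graph_isLink.2 ⟨rfl, h₁⟩)
      (F12Graph_isLink.2 ⟨rfl, h₂⟩) hxx hxy hyx hyy
    rintro a b c ⟨e, he⟩ ⟨f, hf⟩ ⟨g, hg⟩
    exact F12_triangleFree a b c (F12Graph_isLink.1 he).2 (F12Graph_isLink.1 hf).2
      (F12Graph_isLink.1 hg).2
  · let m : Fin 18 := ⟨i, by omega⟩
    obtain ⟨hb, ha⟩ := ear_eq_case m i.2
    obtain ⟨h₁, h₂⟩ := F12Case_adj i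
    obtain ⟨hxx, hxy, -, -⟩ := F12Case_disjoint i
    -- The ear is used without an automorphism: the embedding to be extended is one of the fixed
    -- drawings.
    have hear := (validEar_ear m).isEar (valid_drawing _)
    rw [hb, ha] at hear
    obtain ⟨χ, hχ⟩ := hear.exists_isChord
    refine ⟨(ear m).1, (valid_drawing (ear m).1).isEmbedding.exists_extendsToChord
      (F12Graph_isLink.2 ⟨rfl, h₁⟩) (F12Graph_isLink.2 ⟨rfl, h₂⟩) ?_ hχ⟩
    intro h
    rcases Sym2.eq_iff.1 h with h | h
    exacts [hxx h.1, hxy h.1]
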